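/- Let $n\ge 3$ and let $\Omega\subset\mathbf{C}$ be a convex polygon with vertices $z_1,\dots,z_n$ listed counterclockwise (indices mod $n$; no three vertices collinear). For each $i$ let $\alpha_i=\arg(z_{i+1}-z_i)$, $\sigma_i=\tfrac12|z_{i+1}-z_i|$ and $m_i=\tfrac12(z_i+z_{i+1})$. For $\sigma>0$ let $PW^{\sigma}_{\mathrm{sym}}$ be the real vector space of entire functions $f(\lambda)=\int_{-\sigma}^{\sigma}e^{-\mathrm{i}\lambda\tau}g(\tau)\,\mathrm{d}\tau$ with $g\in L^2[-\sigma,\sigma]$ real valued. Let $X_{\mathrm{sym}}=PW^{\sigma_1}_{\mathrm{sym}}\times\cdots\times PW^{\sigma_n}_{\mathrm{sym}}$ with norm $\|\Phi\|_X=\big(\sum_{i}\int_{-\infty}^{\infty}|\Phi_i(\lambda)|^2\,\mathrm{d}\lambda\big)^{1/2}$, and $Y=L^2(-\infty,0)^n$ with norm $\|\Lambda\|_Y=\big(\sum_{i}\int_{-\infty}^{0}|\Lambda_i(\lambda)|^2\,\mathrm{d}\lambda\big)^{1/2}$. Then \[ (\mathsf{T}\Phi)_i(\lambda)=\Phi_i(\lambda)+\sum_{j\ne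 i}e^{\mathrm{i}e^{-\mathrm{i}\alpha_i}(m_i-m_j)\lambda}\,\Phi_j\big(e^{-\mathrm{i}(\alpha_i-\alpha_j)}\lambda\big),\qquad \lambda<0,\ 1\le i\le n, \] defines a bounded (real-)linear operator $\mathsf{T}\in\mathcal{L}(X_{\mathrm{sym}},Y)$, and $\mathsf{T}$ is bounded below: there is a constant $c>0$, depending only on the polygon, such that $\|\mathsf{T}\Phi\|_Y\ge c\,\|\Phi\|_X$ for all $\Phi\in X_{\mathrm{sym}}$. -/

import Mathlib

noncomputable section

namespace GlobalRelation

open MeasureTheory Complex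

/-! ### Convex polygons in the complex plane -/

/-- A convex polygon, given by its vertices listed counterclockwise: every vertex other than the
two end points of the side from `P i` to the next vertex `P (finRotate n i)` lies strictly to the
left of that directed side. (`finRotate n i` is the cyclic successor of `i`.) -/
def IsConvexPolygon {n : ℕ} (P : Polygon ℂ n) : Prop :=
  3 ≤ n ∧ ∀ i j : Fin n, j ≠ i → j ≠ finRotate n i →
    0 < ((starRingEnd ℂ) (P (finRotate n i) - P i) * (P j - P i)).im

/-- The angle `α i` that the side from `P i` to the next vertex makes with the positive real
axis. -/
def sideAngle {n : ℕ} (P : Polygon ℂ n) (i : Fin n) : ℝ := arg (P (finRotate n i) - P i)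

/-- Half the length of the side from `P i` to the next vertex, `σ i`. -/
def halfLength {n : ℕ} (P : Polygon ℂ n) (i : Fin n) : ℝ := ‖P (finRotate n i) - P i‖ / 2

/-- The midpoint `m i` of the side from `P i` to the next vertex. -/
def sideMid {n : ℕ} (P : Polygon ℂ n) (i : Fin n) : ℂ := (P i + P (finRotate n i)) / 2

/-! ### The symmetric Paley-Wiener spaces -/

/-- The (entire) Fourier transform `z ↦ ∫_{-σ}^{σ} exp(-i z τ) g(τ) dτ` of a real valued
function `g` on `[-σ, σ]`. -/
def fourierOn (σ : ℝ) (g : ℝ → ℝ) (z : ℂ) : ℂ :=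
  ∫ τ in Set.Icc (-σ) σ, exp (-I * z * (τ : ℂ)) * (g τ : ℂ)

theorem integrable_aux {σ : ℝ} {g : ℝ → ℝ} (hg : MemLp g 2 (volume.restrict (Set.Icc (-σ) σ)))
    (z : ℂ) : Integrable (fun τ : ℝ => exp (-I * z * (τ : ℂ)) * (g τ : ℂ))
      (volume.restrict (Set.Icc (-σ) σ)) := by
  have h1 : Integrable (fun τ : ℝ => (g τ : ℂ)) (volume.restrict (Set.Icc (-σ) σ)) :=
    (hg.integrable (by norm_num)).ofReal
  have h2 : IntegrableOn (fun τ : ℝ => (g τ : ℂ)) (Set.Icc (-σ) σ) volume := h1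
  exact h2.continuousOn_mul (by fun_prop) isCompact_Icc

/-- The set `𝓕 L²_ℝ[-σ, σ]` of Fourier transforms of real valued square integrable functions on
`[-σ, σ]`, as a real vector space of functions on `ℂ`. -/
def paleyWienerSym (σ : ℝ) : Submodule ℝ (ℂ → ℂ) where
  carrier := {f | ∃ g : ℝ → ℝ, MemLp g 2 (volume.restrict (Set.Icc (-σ) σ)) ∧
    f = fourierOn σ g}
  zero_mem' := ⟨0, MemLp.zero, by ext z; simp [fourierOn]⟩
  add_mem' := by
    rintro _ _ ⟨g, hg, rfl⟩ ⟨h, hh, rfl⟩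
    refine ⟨g + h, hg.add hh, ?_⟩
    ext z
    simp only [Pi.add_apply, fourierOn]
    rw [← integral_add (integrable_aux hg z) (integrable_aux hh z)]
    congr 1; ext τ; push_cast; ring
  smul_mem' := by
    rintro c _ ⟨g, hg, rfl⟩
    refine ⟨c • g, hg.const_smul c, ?_⟩
    ext z
    simp only [Pi.smul_apply, fourierOn, real_smul, smul_eq_mul]
    rw [← integral_const_mul]
    congr 1; ext τ; push_cast; ring

/-- The space `PW^σ_sym`. A separate type, so that its topology is the one of the `L²(ℝ)` norm
below (and not that of pointwise convergence). -/
def PWSym (σ : ℝ) : Type := paleyWienerSym σ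

namespace PWSym

instance (σ : ℝ) : AddCommGroup (PWSym σ) := inferInstanceAs (AddCommGroup (paleyWienerSym σ))

instance (σ : ℝ) : Module ℝ (PWSym σ) := inferInstanceAs (Module ℝ (paleyWienerSym σ))

/-- The function on the complex plane that an element of `PW^σ_sym` is. -/
def eval {σ : ℝ} (f : PWSym σ) : ℂ → ℂ := Subtype.val (p := (· ∈ paleyWienerSym σ)) f

instance (σ : ℝ) : CoeFun (PWSym σ) (fun _ => ℂ → ℂ) where
  coe := eval

/-- For an integrable `L²` function on the line, the Fourier transform in `L²` is the
Fourier integral. -/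
theorem fourier_toLp_ae {G : ℝ → ℂ} (h1 : Integrable G) (h2 : MemLp G 2) :
    ((FourierTransform.fourier (h2.toLp G) : Lp ℂ 2 (volume : Measure ℝ)) : ℝ → ℂ)
      =ᵐ[volume] FourierTransform.fourier G := by
  have hc : Continuous (FourierTransform.fourier G : ℝ → ℂ) :=
    VectorFourier.fourierIntegral_continuous Real.continuous_fourierChar
      (by exact continuous_inner) h1
  refine ae_eq_of_integral_contDiff_smul_eq
    ((Lp.memLp _).locallyIntegrable (by norm_num)) hc.locallyIntegrable ?_
  intro φ hφ hφc
  have hc' : HasCompactSupport (fun x => (φ x : ℂ)) := hφc.comp_left (g := ofReal) (by simp)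
  have hd' : ContDiff ℝ (⊤ : ℕ∞) (fun x => (φ x : ℂ)) := ofRealCLM.contDiff.comp hφ
  set h : SchwartzMap ℝ ℂ := hc'.toSchwartzMap hd' with hh
  have hv : ∀ x, h x = (φ x : ℂ) := fun x => rfl
  have e1 := congrArg (fun u : TemperedDistribution ℝ ℂ => u h)
    (Lp.fourier_toTemperedDistribution_eq (h2.toLp G))
  simp only [TemperedDistribution.fourier_apply, Lp.toTemperedDistribution_apply] at e1
  have e2 : ∫ x, (FourierTransform.fourier h : SchwartzMap ℝ ℂ) x • (h2.toLp G : ℝ → ℂ) x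
      = ∫ x, (FourierTransform.fourier (h : ℝ → ℂ)) x • G x := by
    apply integral_congr_ae
    filter_upwards [h2.coeFn_toLp] with x hx
    rw [hx, SchwartzMap.fourier_coe]
  have e3 : ∫ x, (FourierTransform.fourier (h : ℝ → ℂ)) x • G x
      = ∫ x, h x • FourierTransform.fourier G x := by
    simpa using! VectorFourier.integral_fourierIntegral_smul_eq_flip (L := innerₗ ℝ)
      Real.continuous_fourierChar continuous_inner h.integrable h1
  have e4 := e1.symm.trans (e2.trans e3)
  simpa [hv, real_smul] using e4

/-- The extension by zero of `g`, as a complex valued function on the line. -/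
def extend (σ : ℝ) (g : ℝ → ℝ) : ℝ → ℂ := (Set.Icc (-σ) σ).indicator fun τ => (g τ : ℂ)

theorem memLp_extend {σ : ℝ} {g : ℝ → ℝ} (hg : MemLp g 2 (volume.restrict (Set.Icc (-σ) σ))) :
    MemLp (extend σ g) 2 :=
  (memLp_indicator_iff_restrict measurableSet_Icc).2 hg.ofReal

theorem integrable_extend {σ : ℝ} {g : ℝ → ℝ}
    (hg : MemLp g 2 (volume.restrict (Set.Icc (-σ) σ))) : Integrable (extend σ g) :=
  (integrable_indicator_iff measurableSet_Icc).2 (hg.integrable (by norm_num)).ofReal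

theorem fourierOn_eq (σ : ℝ) (g : ℝ → ℝ) (x : ℝ) :
    fourierOn σ g x = FourierTransform.fourier (extend σ g) ((2 * Real.pi)⁻¹ * x) := by
  rw [Real.fourier_real_eq_integral_exp_smul, fourierOn, ← integral_indicator measurableSet_Icc]
  congr 1; ext τ
  by_cases hτ : τ ∈ Set.Icc (-σ) σ
  · simp only [extend, Set.indicator_of_mem hτ, smul_eq_mul]
    congr 2
    have : (Real.pi : ℂ) ≠ 0 := by exact_mod_cast Real.pi_ne_zero
    push_cast
    field_simp
  · simp [extend, Set.indicator_of_notMem hτ]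

/-- Elements of `PW^σ_sym` are square integrable on the real line. -/
theorem memLp {σ : ℝ} (f : PWSym σ) : MemLp (fun x : ℝ => f (x : ℂ)) 2 := by
  obtain ⟨f, g, hg, rfl⟩ := f
  have hF : MemLp (FourierTransform.fourier (extend σ g) : ℝ → ℂ) 2 :=
    (memLp_congr_ae (fourier_toLp_ae (integrable_extend hg) (memLp_extend hg))).1 (Lp.memLp _)
  have hp : (2 * Real.pi)⁻¹ ≠ 0 := by positivity
  have h3 : MemLp (FourierTransform.fourier (extend σ g) : ℝ → ℂ) 2
      (Measure.map (fun x => (2 * Real.pi)⁻¹ * x) volume) := by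
    rw [Real.map_volume_mul_left hp]
    exact hF.smul_measure ENNReal.ofReal_ne_top
  have h4 := h3.comp_of_map (by fun_prop)
  exact h4.congr_norm h4.1 (by simp) |>.ae_eq (by
    exact Filter.Eventually.of_forall fun x => (fourierOn_eq σ g x).symm)

/-- Restriction of the elements of `PW^σ_sym` to the real line. -/
def toL2 (σ : ℝ) : PWSym σ →ₗ[ℝ] Lp ℂ 2 (volume : Measure ℝ) where
  toFun f := (memLp f).toLp _
  map_add' f g := (memLp f).toLp_add (memLp g)
  map_smul' c f := (memLp f).toLp_const_smul c

theorem toL2_injective (σ : ℝ) : Function.Injective (toL2 σ) := by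
  rw [injective_iff_map_eq_zero]
  rintro ⟨f, g, hg, rfl⟩ hf
  have hp : (2 * Real.pi)⁻¹ ≠ 0 := by positivity
  have h1 : ∀ᵐ x : ℝ, fourierOn σ g x = 0 :=
    (MemLp.coeFn_toLp (memLp ⟨_, g, hg, rfl⟩)).symm.trans ((Lp.eq_zero_iff_ae_eq_zero).1 hf)
  have h2 : ∀ᵐ y : ℝ, FourierTransform.fourier (extend σ g) y = 0 := by
    have hq : (2 * Real.pi) ≠ 0 := by positivity
    have hm : Measure.QuasiMeasurePreserving (fun y : ℝ => 2 * Real.pi * y) volume volume :=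
      ⟨by fun_prop, by
        rw [Real.map_volume_mul_left hq]
        exact Measure.smul_absolutelyContinuous⟩
    filter_upwards [hm.ae h1] with y hy
    rwa [fourierOn_eq, ← mul_assoc, inv_mul_cancel₀ hq, one_mul] at hy
  have h3 : (FourierTransform.fourier ((memLp_extend hg).toLp _) : Lp ℂ 2 (volume : Measure ℝ))
      = 0 :=
    (Lp.eq_zero_iff_ae_eq_zero).2
      ((fourier_toLp_ae (integrable_extend hg) (memLp_extend hg)).trans h2)
  have h4 : (memLp_extend hg).toLp _ = 0 := by
    rw [← norm_eq_zero, ← Lp.norm_fourier_eq, h3, norm_zero]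
  have h5 : extend σ g =ᵐ[volume] 0 :=
    (MemLp.coeFn_toLp _).symm.trans ((Lp.eq_zero_iff_ae_eq_zero).1 h4)
  apply Subtype.ext
  ext z
  change fourierOn σ g z = 0
  rw [fourierOn, ← integral_indicator measurableSet_Icc]
  refine integral_eq_zero_of_ae (h5.mono fun τ hτ => ?_)
  by_cases h : τ ∈ Set.Icc (-σ) σ
  · simp only [extend, Set.indicator_of_mem h, Pi.zero_apply] at hτ
    simp [Set.indicator_of_mem h, hτ]
  · simp [Set.indicator_of_notMem h]

/-- `PW^σ_sym` carries the norm of `L²(ℝ)`. -/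
instance (σ : ℝ) : NormedAddCommGroup (PWSym σ) :=
  NormedAddCommGroup.induced _ _ (toL2 σ) (toL2_injective σ)

instance (σ : ℝ) : NormedSpace ℝ (PWSym σ) := NormedSpace.induced ℝ _ _ (toL2 σ)

/-- The norm of `PW^σ_sym` is the `L²` norm on the real line. -/
theorem norm_sq {σ : ℝ} (f : PWSym σ) : ‖f‖ ^ 2 = ∫ x : ℝ, ‖f (x : ℂ)‖ ^ 2 := by
  have h0 : ‖f‖ = ‖(memLp f).toLp _‖ := rfl
  have h1 : ((‖(memLp f).toLp _‖ ^ 2 : ℝ) : ℂ) = ((∫ x : ℝ, ‖f (x : ℂ)‖ ^ 2 : ℝ) : ℂ) := by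
    rw [ofReal_pow, ← integral_complex_ofReal]
    refine (inner_self_eq_norm_sq_to_K (𝕜 := ℂ) ((memLp f).toLp _)).symm.trans ?_
    rw [L2.inner_def]
    refine integral_congr_ae ((memLp f).coeFn_toLp.mono fun x hx => ?_)
    simp only [hx, inner_self_eq_norm_sq_to_K]
    push_cast
    rfl
  rw [h0]
  exact_mod_cast h1

end PWSym

/-! ### The spaces `X_sym` and `Y`, and the global relation -/

/-- `X_sym = PW^{σ_1}_sym × ⋯ × PW^{σ_n}_sym`, a real normed space with
`‖Φ‖ = (∑ i, ‖Φ i‖²)^{1/2}`. -/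
abbrev XSym {n : ℕ} (P : Polygon ℂ n) : Type := PiLp 2 fun i : Fin n => PWSym (halfLength P i)

/-- `Y = L²(ℝ⁻)^n` with `‖Λ‖ = (∑ i, ‖Λ i‖²)^{1/2}`. -/
abbrev YSpace (n : ℕ) : Type :=
  PiLp 2 fun _ : Fin n => Lp ℂ 2 (volume.restrict (Set.Iio (0 : ℝ)))

/-- The norm of `X_sym` is `(∑ i, ∫ |Φ_i(x)|² dx)^{1/2}`. -/
theorem norm_sq_XSym {n : ℕ} (P : Polygon ℂ n) (Φ : XSym P) :
    ‖Φ‖ ^ 2 = ∑ i, ∫ x : ℝ, ‖Φ i (x : ℂ)‖ ^ 2 := by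
  rw [PiLp.norm_sq_eq_of_L2]
  exact Finset.sum_congr rfl fun i _ => PWSym.norm_sq (Φ i)

/-- The component `(TΦ)_i` of the global relation operator, as an entire function:
`Φ_i(z) + ∑_{j ≠ i} exp(i e^{-i α_i} (m_i - m_j) z) Φ_j(e^{-i (α_i - α_j)} z)`. -/
def globalRelation {n : ℕ} (P : Polygon ℂ n) (Φ : XSym P) (i : Fin n) (z : ℂ) : ℂ :=
  Φ i z + ∑ j ∈ Finset.univ.erase i,
    exp (I * exp (-I * (sideAngle P i : ℂ)) * (sideMid P i - sideMid P j) * z) *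
      Φ j (exp (-I * ((sideAngle P i - sideAngle P j : ℝ) : ℂ)) * z)

end GlobalRelation

end

/-! Let `w_i` be the coordinate `sideCoord P i`, in which side `i` is real and the polygon lies in
the upper half plane. If `Φ_j` has density `g_j`, the two exponential factors of the `j`-th term
merge (`sideTerm_fourierOn`) and the term becomes `∫ exp(-i x w_i(p_j(τ))) g_j(τ) dτ`, with `p_j`
the arc length parametrisation of side `j`.

Boundedness. For `j = i` the term is a restriction of `Φ_i`. For `j ≠ i` it is dominated by a
Laplace transform with exponent `Im w_i(p_j(τ))`, which is affine in `τ` and positive on the open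
side. A Schur test bounds it, or Cauchy-Schwarz if the sides are parallel
(`exists_lintegral_laplace_sq_le`).

Lower bound. By density, take real smooth densities `φ_i` supported inside the open sides. The half
of each Fourier integral over `x > 0` defines a field `u`, holomorphic in the polygon and continuous
up to its boundary. The half over `x < 0` of the global relation gives, after inverse Fourier
transform, a function `V_i`. Fourier inversion on side `i`, and equality of Cauchy kernels for the
other sides, give `exp(i α_i) u = φ_i - V_i` on side `i` (`sideDir_mul_interiorField`). By
Plancherel, `2π ‖V_i‖²` on the line is `‖(TΦ)_i‖²`, so it remains to control `φ` by `V`.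

This is a Rellich argument (`exists_rellich`). Cauchy's theorem for `(z - z₀) u²`, with `z₀` inside,
reads `∑ ∫ (s - w_i(z₀)) (φ_i - V_i)² ds = 0`. In the imaginary part the coefficient of `φ_i²` is
`-Im w_i(z₀)`, minus the distance from `z₀` to the line of side `i`. Because `φ_i` is real, these
terms all have one sign and add up, while everything else contains a factor `V_i` and is absorbed.
-/

noncomputable section

namespace GlobalRelation

open MeasureTheory Complex

/-! ### Geometry of convex polygons -/

/-- The unit vector along the side from `P i` to the next vertex. -/
def sideDir {n : ℕ} (P : Polygon ℂ n) (i : Fin n) : ℂ := exp (I * (sideAngle P i : ℂ))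

/-- The arc length parametrisation of the line through the side from `P i` to the next vertex,
centred at the midpoint. -/
def sidePoint {n : ℕ} (P : Polygon ℂ n) (i : Fin n) (s : ℝ) : ℂ :=
  sideMid P i + sideDir P i * (s : ℂ)

/-- The coordinate in which the side from `P i` to the next vertex lies on the real axis, centred
at the origin, and the polygon lies in the upper half plane. -/
def sideCoord {n : ℕ} (P : Polygon ℂ n) (i : Fin n) (z : ℂ) : ℂ :=
  exp (-I * (sideAngle P i : ℂ)) * (z - sideMid P i)

section Geometry

variable {n : ℕ} {P : Polygon ℂ n}

theorem sideDir_ne_zero (i : Fin n) : sideDir P i ≠ 0 := exp_ne_zero _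

theorem norm_sideDir (i : Fin n) : ‖sideDir P i‖ = 1 := by
  rw [sideDir, mul_comm, norm_exp_ofReal_mul_I]

theorem exp_neg_sideAngle (i : Fin n) :
    exp (-I * (sideAngle P i : ℂ)) = (sideDir P i)⁻¹ := by
  rw [sideDir, ← exp_neg, neg_mul]

theorem sideCoord_eq (i : Fin n) (z : ℂ) :
    sideCoord P i z = (sideDir P i)⁻¹ * (z - sideMid P i) := by
  rw [sideCoord, exp_neg_sideAngle]

theorem sideDir_mul_sideCoord (i : Fin n) (z : ℂ) :
    sideDir P i * sideCoord P i z = z - sideMid P i := by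
  rw [sideCoord_eq, mul_inv_cancel_left₀ (sideDir_ne_zero i)]

theorem sideCoord_sidePoint (i : Fin n) (s : ℝ) : sideCoord P i (sidePoint P i s) = s := by
  rw [sideCoord_eq, sidePoint, add_sub_cancel_left, inv_mul_cancel_left₀ (sideDir_ne_zero i)]

theorem continuous_sidePoint (i : Fin n) : Continuous (sidePoint P i) := by
  unfold sidePoint; fun_prop

theorem continuous_sideCoord (i : Fin n) : Continuous (sideCoord P i) := by
  unfold sideCoord; fun_prop

theorem differentiable_sideCoord (i : Fin n) : Differentiable ℂ (sideCoord P i) := by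
  unfold sideCoord; fun_prop

theorem sideCoord_combo (i : Fin n) (x y : ℂ) (a b : ℝ) (hab : a + b = 1) :
    sideCoord P i (a * x + b * y) = a * sideCoord P i x + b * sideCoord P i y := by
  have h : (a : ℂ) + b = 1 := by exact_mod_cast hab
  simp only [sideCoord]
  linear_combination (exp (-I * (sideAngle P i : ℂ)) * sideMid P i) * h

theorem im_sideCoord_combo (i : Fin n) (x y : ℂ) (a b : ℝ) (hab : a + b = 1) :
    (sideCoord P i (a * x + b * y)).im = a * (sideCoord P i x).im + b * (sideCoord P i y).im := by
  rw [sideCoord_combo i x y a b hab, add_im, im_ofReal_mul, im_ofReal_mul]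

theorem two_halfLength_mul_sideDir (i : Fin n) :
    2 * (halfLength P i : ℂ) * sideDir P i = P (finRotate n i) - P i := by
  have h := norm_mul_exp_arg_mul_I (P (finRotate n i) - P i)
  rw [halfLength, sideDir, sideAngle, mul_comm I]
  push_cast
  linear_combination h

theorem sidePoint_halfLength (i : Fin n) : sidePoint P i (halfLength P i) = P (finRotate n i) := by
  rw [sidePoint, sideMid]
  linear_combination (1 / 2 : ℂ) * two_halfLength_mul_sideDir (P := P) i

theorem sidePoint_neg_halfLength (i : Fin n) : sidePoint P i (-halfLength P i) = P i := by
  rw [sidePoint, sideMid]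
  push_cast
  linear_combination (-1 / 2 : ℂ) * two_halfLength_mul_sideDir (P := P) i

theorem finRotate_ne_self (hn : 3 ≤ n) (i : Fin n) : finRotate n i ≠ i := by
  obtain ⟨m, rfl⟩ : ∃ m, n = m + 3 := ⟨n - 3, by omega⟩
  rw [finRotate_apply, Ne, add_eq_left, Fin.ext_iff]
  simp

theorem finRotate_finRotate_ne_self (hn : 3 ≤ n) (i : Fin n) :
    finRotate n (finRotate n i) ≠ i := by
  obtain ⟨m, rfl⟩ : ∃ m, n = m + 3 := ⟨n - 3, by omega⟩
  rw [finRotate_apply, finRotate_apply, add_assoc, Ne, add_eq_left, Fin.ext_iff, Fin.val_add]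
  simp [Nat.mod_eq_of_lt]

variable (hP : IsConvexPolygon P)
include hP

theorem IsConvexPolygon.exists_ne (i : Fin n) : ∃ j : Fin n, j ≠ i ∧ j ≠ finRotate n i :=
  ⟨finRotate n (finRotate n i), finRotate_finRotate_ne_self hP.1 i,
    finRotate_ne_self hP.1 (finRotate n i)⟩

theorem IsConvexPolygon.halfLength_pos (i : Fin n) : 0 < halfLength P i := by
  obtain ⟨j, h1, h2⟩ := hP.exists_ne i
  have h := hP.2 i j h1 h2
  have : P (finRotate n i) - P i ≠ 0 := by
    intro h0
    rw [h0, map_zero, zero_mul, zero_im] at h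
    exact h.false
  have := norm_pos_iff.2 this
  unfold halfLength; positivity

/-- The product in the convexity hypothesis equals `2 σ_i (w + σ_i)` with `w` the coordinate of `P
j`; both `σ_i`s are real and `2 σ_i > 0`, so the sign is that of `w.im`. -/
theorem IsConvexPolygon.im_sideCoord_vertex_pos {i j : Fin n} (h1 : j ≠ i)
    (h2 : j ≠ finRotate n i) : 0 < (sideCoord P i (P j)).im := by
  have h := hP.2 i j h1 h2
  have hσ := hP.halfLength_pos i
  have hd := norm_sideDir (P := P) i
  have hc : (starRingEnd ℂ) (sideDir P i) = (sideDir P i)⁻¹ := by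
    rw [Complex.inv_def, normSq_eq_norm_sq, hd]; simp
  have key : (starRingEnd ℂ) (P (finRotate n i) - P i) * (P j - P i)
      = ((2 * halfLength P i : ℝ) : ℂ) * (sideCoord P i (P j) + (halfLength P i : ℝ)) := by
    have e : P i = sideMid P i - sideDir P i * halfLength P i := by
      have := sidePoint_neg_halfLength (P := P) i
      rw [sidePoint] at this
      push_cast at this
      linear_combination -this
    rw [← two_halfLength_mul_sideDir, map_mul, map_mul, hc, sideCoord_eq, conj_ofReal,
      map_ofNat]
    rw [e]
    have := sideDir_ne_zero (P := P) i
    push_cast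
    field_simp
    ring
  rw [key, im_ofReal_mul, add_im, ofReal_im, add_zero] at h
  exact pos_of_mul_pos_right h (by positivity)

theorem IsConvexPolygon.im_sideCoord_vertex_nonneg (i j : Fin n) :
    0 ≤ (sideCoord P i (P j)).im := by
  by_cases h1 : j = i
  · rw [h1, ← sidePoint_neg_halfLength, sideCoord_sidePoint, ofReal_im]
  by_cases h2 : j = finRotate n i
  · rw [h2, ← sidePoint_halfLength, sideCoord_sidePoint, ofReal_im]
  exact (hP.im_sideCoord_vertex_pos h1 h2).le

theorem IsConvexPolygon.sidePoint_combo (j : Fin n) (s : ℝ) :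
    sidePoint P j s = ((1 - s / halfLength P j) / 2 : ℝ) * P j +
      ((1 + s / halfLength P j) / 2 : ℝ) * P (finRotate n j) := by
  have hσ : (halfLength P j : ℂ) ≠ 0 := by exact_mod_cast (hP.halfLength_pos j).ne'
  rw [sidePoint, sideMid]
  push_cast
  have := two_halfLength_mul_sideDir (P := P) j
  field_simp
  linear_combination (s : ℂ) * this

theorem IsConvexPolygon.im_sideCoord_sidePoint (i j : Fin n) (s : ℝ) :
    (sideCoord P i (sidePoint P j s)).im =
      (1 - s / halfLength P j) / 2 * (sideCoord P i (P j)).im +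
      (1 + s / halfLength P j) / 2 * (sideCoord P i (P (finRotate n j))).im := by
  rw [hP.sidePoint_combo, im_sideCoord_combo _ _ _ _ _ (by ring)]

theorem IsConvexPolygon.im_sideCoord_sidePoint_nonneg (i j : Fin n) {s : ℝ}
    (hs : s ∈ Set.Icc (-halfLength P j) (halfLength P j)) :
    0 ≤ (sideCoord P i (sidePoint P j s)).im := by
  have hσ := hP.halfLength_pos j
  have h1 : s / halfLength P j ≤ 1 := (div_le_one hσ).2 hs.2
  have h2 : -1 ≤ s / halfLength P j := by rw [le_div_iff₀ hσ]; linarith [hs.1]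
  rw [hP.im_sideCoord_sidePoint]
  have := hP.im_sideCoord_vertex_nonneg i j
  have := hP.im_sideCoord_vertex_nonneg i (finRotate n j)
  exact add_nonneg (mul_nonneg (by linarith) ‹_›) (mul_nonneg (by linarith) ‹_›)

/-- Two distinct sides share at most one vertex, so some end point of side `j` lies strictly above
side `i`, and an interior point of side `j` gives it positive weight. -/
theorem IsConvexPolygon.im_sideCoord_sidePoint_pos {i j : Fin n} (hij : j ≠ i) {s : ℝ}
    (hs : s ∈ Set.Ioo (-halfLength P j) (halfLength P j)) :
    0 < (sideCoord P i (sidePoint P j s)).im := by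
  have hσ := hP.halfLength_pos j
  have h1 : s / halfLength P j < 1 := (div_lt_one hσ).2 hs.2
  have h2 : -1 < s / halfLength P j := by rw [lt_div_iff₀ hσ]; linarith [hs.1]
  rw [hP.im_sideCoord_sidePoint]
  have h3 := hP.im_sideCoord_vertex_nonneg i j
  have h4 := hP.im_sideCoord_vertex_nonneg i (finRotate n j)
  by_cases h : j = finRotate n i
  · have : finRotate n j ≠ i := h ▸ finRotate_finRotate_ne_self hP.1 i
    have h5 := hP.im_sideCoord_vertex_pos (i := i) this
      (h ▸ finRotate_ne_self hP.1 (finRotate n i))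
    exact add_pos_of_nonneg_of_pos (mul_nonneg (by linarith) h3) (mul_pos (by linarith) h5)
  · have h5 := hP.im_sideCoord_vertex_pos hij h
    exact add_pos_of_pos_of_nonneg (mul_pos (by linarith) h5) (mul_nonneg (by linarith) h4)

/-- A convex polygon has an interior point: the barycentre of its vertices. -/
theorem IsConvexPolygon.exists_interior : ∃ z₀ : ℂ, ∀ i, 0 < (sideCoord P i z₀).im := by
  have hn : (n : ℝ) ≠ 0 := by have := hP.1; positivity
  refine ⟨((n : ℝ)⁻¹ : ℝ) * ∑ j, P j, fun i => ?_⟩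
  have e : (sideCoord P i (((n : ℝ)⁻¹ : ℝ) * ∑ j, P j)).im
      = (n : ℝ)⁻¹ * ∑ j, (sideCoord P i (P j)).im := by
    have : sideCoord P i (((n : ℝ)⁻¹ : ℝ) * ∑ j, P j)
        = ((n : ℝ)⁻¹ : ℝ) * ∑ j, sideCoord P i (P j) := by
      simp only [sideCoord, ← Finset.mul_sum, Finset.sum_sub_distrib]
      have : (n : ℂ) ≠ 0 := by exact_mod_cast hn
      simp
      field_simp
    rw [this, im_ofReal_mul, im_sum]
  rw [e]
  obtain ⟨j, h1, h2⟩ := hP.exists_ne i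
  refine mul_pos (by have := hP.1; positivity) ?_
  exact Finset.sum_pos' (fun j _ => hP.im_sideCoord_vertex_nonneg i j)
    ⟨j, Finset.mem_univ _, hP.im_sideCoord_vertex_pos h1 h2⟩

omit hP in
theorem convex_interior : Convex ℝ {z : ℂ | ∀ i, 0 < (sideCoord P i z).im} := by
  intro x hx y hy a b ha hb hab i
  rw [real_smul, real_smul, im_sideCoord_combo _ _ _ _ _ hab]
  rcases ha.eq_or_lt with rfl | ha
  · have := hy i
    simp_all
  · exact add_pos_of_pos_of_nonneg (mul_pos ha (hx i)) (mul_nonneg hb (hy i).le)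

omit hP in
theorem isOpen_interior : IsOpen {z : ℂ | ∀ i, 0 < (sideCoord P i z).im} := by
  simp only [Set.ofPred_forall]
  exact isOpen_iInter_of_finite fun i =>
    isOpen_lt continuous_const (continuous_im.comp (continuous_sideCoord i))

/-- Cauchy's theorem for a convex polygon, for functions holomorphic inside and continuous up to
the boundary. -/
theorem IsConvexPolygon.sum_integral_eq_zero {f : ℂ → ℂ}
    (hc : ContinuousOn f {z : ℂ | ∀ i, 0 ≤ (sideCoord P i z).im})
    (hd : DifferentiableOn ℂ f {z : ℂ | ∀ i, 0 < (sideCoord P i z).im}) :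
    ∑ i, ∫ s in (-halfLength P i)..(halfLength P i), f (sidePoint P i s) * sideDir P i = 0 := by
  obtain ⟨z₀, hz₀⟩ := hP.exists_interior
  -- A primitive is available only in the open polygon, so the contour is first contracted towards
  -- `z₀` by a factor `r < 1`, and then `r → 1`.
  obtain ⟨F, hF⟩ := convex_interior.exists_forall_hasDerivWithinAt hd
  have hF' : ∀ z ∈ {z : ℂ | ∀ i, 0 < (sideCoord P i z).im}, HasDerivAt F (f z) z := fun z hz =>
    (hF z hz).hasDerivAt (isOpen_interior.mem_nhds hz)
  have hin : ∀ (i : Fin n) (s : ℝ), s ∈ Set.Icc (-halfLength P i) (halfLength P i) →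
      ∀ r : ℝ, 0 ≤ r → r < 1 → ∀ k,
        0 < (sideCoord P k (((1 - r : ℝ) : ℂ) * z₀ + (r : ℂ) * sidePoint P i s)).im := by
    intro i s hs r hr0 hr1 k
    rw [im_sideCoord_combo _ _ _ _ _ (by ring)]
    exact add_pos_of_pos_of_nonneg (mul_pos (by linarith) (hz₀ k))
      (mul_nonneg hr0 (hP.im_sideCoord_sidePoint_nonneg k i hs))
  -- the integral over the polygon shrunk by the factor `r`
  let J : Fin n → ℝ → ℂ := fun i r => ∫ s in (-halfLength P i)..(halfLength P i),
    f (((1 - Set.projIcc 0 1 zero_le_one r : ℝ) : ℂ) * z₀ +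
      ((Set.projIcc 0 1 zero_le_one r : ℝ) : ℂ) * sidePoint P i
        (Set.projIcc (-halfLength P i) (halfLength P i)
          (by linarith [hP.halfLength_pos i]) s)) * sideDir P i
  -- Clamping both variables with `projIcc` keeps the argument of `f` in the closed polygon for all
  -- real `r` and `s`, so that continuity of a parametric integral applies globally.
  have hJc : ∀ i, Continuous (J i) := by
    intro i
    refine intervalIntegral.continuous_parametric_intervalIntegral_of_continuous' ?_ _ _
    refine Continuous.mul ?_ continuous_const
    refine hc.comp_continuous ?_ ?_
    · have h1 : Continuous fun p : ℝ × ℝ => ((Set.projIcc (0 : ℝ) 1 zero_le_one p.1 : ℝ)) :=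
        continuous_subtype_val.comp (continuous_projIcc.comp continuous_fst)
      have h2 : Continuous fun p : ℝ × ℝ => ((Set.projIcc (-halfLength P i) (halfLength P i)
          (by linarith [hP.halfLength_pos i]) p.2 : ℝ)) :=
        continuous_subtype_val.comp (continuous_projIcc.comp continuous_snd)
      have h3 := (continuous_sidePoint (P := P) i).comp h2
      have h4 := continuous_ofReal.comp h1
      have h5 := continuous_ofReal.comp (continuous_const.sub h1 : Continuous fun p : ℝ × ℝ =>
        1 - (Set.projIcc (0 : ℝ) 1 zero_le_one p.1 : ℝ))
      exact (h5.mul continuous_const).add (h4.mul h3)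
    · rintro ⟨r, s⟩ k
      obtain ⟨r', hr0, hr1⟩ := Set.projIcc (0 : ℝ) 1 zero_le_one r
      obtain ⟨s', hs'⟩ := Set.projIcc (-halfLength P i) (halfLength P i)
          (by linarith [hP.halfLength_pos i]) s
      dsimp only
      rw [im_sideCoord_combo _ _ _ _ _ (by ring)]
      exact add_nonneg (mul_nonneg (by linarith) (hz₀ k).le)
        (mul_nonneg hr0 (hP.im_sideCoord_sidePoint_nonneg k i hs'))
  have hJ0 : ∀ r ∈ Set.Ioo (0 : ℝ) 1, ∑ i, J i r = 0 := by
    intro r hr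
    have hri : Set.projIcc (0 : ℝ) 1 zero_le_one r = ⟨r, hr.1.le, hr.2.le⟩ :=
      Set.projIcc_of_mem _ ⟨hr.1.le, hr.2.le⟩
    have e : ∀ i, (r : ℂ) * J i r = F (((1 - r : ℝ) : ℂ) * z₀ + (r : ℂ) * P (finRotate n i))
        - F (((1 - r : ℝ) : ℂ) * z₀ + (r : ℂ) * P i) := by
      intro i
      have hσ := hP.halfLength_pos i
      have e1 : (r : ℂ) * J i r = ∫ s in (-halfLength P i)..(halfLength P i),
          f (((1 - r : ℝ) : ℂ) * z₀ + (r : ℂ) * sidePoint P i s) * (r * sideDir P i) := by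
        simp only [J]
        rw [← intervalIntegral.integral_const_mul]
        refine intervalIntegral.integral_congr fun s hs => ?_
        rw [Set.uIcc_of_le (by linarith)] at hs
        simp only [hri, Set.projIcc_of_mem _ hs]
        ring
      rw [e1, intervalIntegral.integral_eq_sub_of_hasDerivAt
        (f := fun s : ℝ => F (((1 - r : ℝ) : ℂ) * z₀ + (r : ℂ) * sidePoint P i s)),
        sidePoint_halfLength, sidePoint_neg_halfLength]
      · intro s hs
        rw [Set.uIcc_of_le (by linarith)] at hs
        have h1 := hF' _ (hin i s hs r hr.1.le hr.2)
        have h2 : HasDerivAt (fun s : ℝ => ((1 - r : ℝ) : ℂ) * z₀ + (r : ℂ) * sidePoint P i s)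
            (r * sideDir P i) s := by
          have h3 : HasDerivAt (fun s : ℝ => sidePoint P i s) (sideDir P i) s := by
            simpa [sidePoint] using
              ((ofRealCLM.hasDerivAt (x := s)).const_mul (sideDir P i)).const_add (sideMid P i)
          exact (h3.const_mul (r : ℂ)).const_add _
        exact h1.comp_of_eq s h2 rfl
      · refine ContinuousOn.intervalIntegrable ?_
        rw [Set.uIcc_of_le (by linarith)]
        refine ContinuousOn.mul ?_ continuousOn_const
        refine hc.comp ?_ fun s hs k => (hin i s hs r hr.1.le hr.2 k).le
        exact (continuous_const.add
          (continuous_const.mul (continuous_sidePoint i))).continuousOn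
    -- The increments of the primitive cancel around the polygon, as `finRotate` permutes the
    -- vertices.
    have h2 : (r : ℂ) * ∑ i, J i r = 0 := by
      rw [Finset.mul_sum, Finset.sum_congr rfl fun i _ => e i, Finset.sum_sub_distrib, sub_eq_zero]
      exact Equiv.sum_comp (finRotate n)
        fun i => F (((1 - r : ℝ) : ℂ) * z₀ + (r : ℂ) * P i)
    have hr' : (r : ℂ) ≠ 0 := by exact_mod_cast hr.1.ne'
    exact (mul_eq_zero.1 h2).resolve_left hr'
  have hJ1 : ∑ i, J i 1 = 0 := by
    have hcl : (1 : ℝ) ∈ closure (Set.Ioo (0 : ℝ) 1) := by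
      rw [closure_Ioo zero_ne_one]; exact ⟨zero_le_one, le_rfl⟩
    have hcont : Continuous fun r => ∑ i, J i r := continuous_finsetSum _ fun i _ => hJc i
    have := (isClosed_eq hcont continuous_const).closure_subset_iff.2
      (show Set.Ioo (0 : ℝ) 1 ⊆ {r | ∑ i, J i r = 0} from hJ0)
    exact this hcl
  rw [← hJ1]
  refine Finset.sum_congr rfl fun i _ => ?_
  simp only [J]
  refine intervalIntegral.integral_congr fun s hs => ?_
  rw [Set.uIcc_of_le (by linarith [hP.halfLength_pos i])] at hs
  simp [Set.projIcc_of_mem _ hs]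

end Geometry

/-! ### Square integrals and the Plancherel identity -/

theorem eLpNorm_two_sq {α E : Type*} [MeasurableSpace α] [NormedAddCommGroup E] (f : α → E)
    (μ : Measure α) : eLpNorm f 2 μ ^ 2 = ∫⁻ x, ‖f x‖ₑ ^ 2 ∂μ := by
  have h := eLpNorm_nnreal_pow_eq_lintegral (f := f) (μ := μ) (p := 2) two_ne_zero
  simpa using h

theorem lintegral_comp_add_mul {b : ℝ} (hb : b ≠ 0) (a : ℝ) (F : ℝ → ENNReal) :
    ∫⁻ τ, F (a + b * τ) = ENNReal.ofReal |b⁻¹| * ∫⁻ y, F y := by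
  rw [← lintegral_add_left_eq_self F a, ← smul_eq_mul, ← lintegral_smul_measure, ← Real.map_volume_mul_left hb]
  exact ((Homeomorph.mulLeft₀ b hb).measurableEmbedding.lintegral_map
    (fun y => F (a + y))).symm

/-- The Plancherel identity for the Fourier integral. -/
theorem lintegral_enorm_fourier_sq {G : ℝ → ℂ} (h1 : Integrable G) (h2 : MemLp G 2) :
    ∫⁻ x, ‖FourierTransform.fourier G x‖ₑ ^ 2 = ∫⁻ x, ‖G x‖ₑ ^ 2 := by
  rw [← eLpNorm_two_sq, ← eLpNorm_two_sq]
  congr 1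
  rw [← eLpNorm_congr_ae (PWSym.fourier_toLp_ae h1 h2), ← eLpNorm_congr_ae h2.coeFn_toLp,
    ← Lp.enorm_def, ← Lp.enorm_def, ← ofReal_norm, ← ofReal_norm,
    Lp.norm_fourier_eq]

/-- The factor `2π` comes from rescaling: `fourierOn` has kernel `exp(-i x τ)`, while the unitary
transform has frequency `x / 2π`. -/
theorem lintegral_enorm_fourierOn_sq {σ : ℝ} {g : ℝ → ℝ}
    (hg : MemLp g 2 (volume.restrict (Set.Icc (-σ) σ))) :
    ∫⁻ x : ℝ, ‖fourierOn σ g x‖ₑ ^ 2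
      = ENNReal.ofReal (2 * Real.pi) * ∫⁻ τ in Set.Icc (-σ) σ, ‖g τ‖ₑ ^ 2 := by
  have hp : (2 * Real.pi)⁻¹ ≠ 0 := by positivity
  have h := lintegral_comp_add_mul hp 0
    (fun y => ‖FourierTransform.fourier (PWSym.extend σ g) y‖ₑ ^ 2)
  simp only [zero_add, ← PWSym.fourierOn_eq, inv_inv] at h
  rw [h, lintegral_enorm_fourier_sq (PWSym.integrable_extend hg) (PWSym.memLp_extend hg),
    abs_of_pos (by positivity), ← lintegral_indicator measurableSet_Icc]
  congr 2
  ext τ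
  by_cases hτ : τ ∈ Set.Icc (-σ) σ
  · simp [PWSym.extend, Set.indicator_of_mem hτ, enorm_eq_nnnorm]
  · simp [PWSym.extend, Set.indicator_of_notMem hτ]

/-! ### Boundedness of the Laplace transform -/

theorem sq_lintegral_mul_le {α : Type*} [MeasurableSpace α] (μ : Measure α)
    {f g : α → ENNReal} (hf : AEMeasurable f μ) (hg : AEMeasurable g μ) :
    (∫⁻ a, f a * g a ∂μ) ^ 2 ≤ (∫⁻ a, f a ^ 2 ∂μ) * ∫⁻ a, g a ^ 2 ∂μ := by
  have h := ENNReal.lintegral_mul_le_Lp_mul_Lq μ Real.HolderConjugate.two_two hf hg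
  have e : ∀ x : ENNReal, (x ^ (1 / 2 : ℝ)) ^ 2 = x := fun x => by
    rw [← ENNReal.rpow_natCast, ← ENNReal.rpow_mul]; simp
  calc (∫⁻ a, f a * g a ∂μ) ^ 2 ≤ _ := pow_le_pow_left₀ zero_le h 2
    _ = _ := by rw [mul_pow, e, e]; simp

/-- A Gamma integral with `Γ(1/2) = √π`. The Schur test uses it twice, once in each variable of the
kernel. -/
theorem lintegral_rpow_neg_half_mul_exp {c : ℝ} (hc : 0 < c) :
    ∫⁻ y in Set.Ioi 0, ENNReal.ofReal (Real.exp (-(c * y)) * y ^ (-1 / 2 : ℝ))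
      = ENNReal.ofReal (Real.sqrt Real.pi * c ^ (-1 / 2 : ℝ)) := by
  have h := Real.integral_rpow_mul_exp_neg_mul_Ioi (a := 1 / 2) (by norm_num) hc
  rw [Real.Gamma_one_half_eq] at h
  have hne : (1 / c) ^ (1 / 2 : ℝ) * Real.sqrt Real.pi ≠ 0 := by positivity
  have hi := Integrable.of_integral_ne_zero (h ▸ hne)
  have e : ∀ y : ℝ, Real.exp (-(c * y)) * y ^ (-1 / 2 : ℝ)
      = y ^ (1 / 2 - 1 : ℝ) * Real.exp (-(c * y)) := fun y => by
    rw [mul_comm]; norm_num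
  simp only [e]
  rw [← ofReal_integral_eq_lintegral_ofReal hi, h, mul_comm, one_div, Real.inv_rpow hc.le,
    ← Real.rpow_neg hc.le, neg_div]
  filter_upwards [ae_restrict_mem measurableSet_Ioi] with y hy
  have : (0 : ℝ) < y := hy
  positivity

theorem lintegral_Ioo_rpow_neg_half_mul_exp_le {a b σ x : ℝ} (hb : b ≠ 0)
    (hpos : ∀ τ ∈ Set.Ioo (-σ) σ, 0 < a + b * τ) (hx : x < 0) :
    ∫⁻ τ in Set.Ioo (-σ) σ,
        ENNReal.ofReal (Real.exp (x * (a + b * τ)) * (a + b * τ) ^ (-1 / 2 : ℝ))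
      ≤ ENNReal.ofReal (|b⁻¹| * (Real.sqrt Real.pi * (-x) ^ (-1 / 2 : ℝ))) := by
  rw [ENNReal.ofReal_mul (abs_nonneg _), ← lintegral_rpow_neg_half_mul_exp (neg_pos.2 hx),
    ← lintegral_indicator measurableSet_Ioi, ← lintegral_comp_add_mul hb a,
    ← lintegral_indicator measurableSet_Ioo]
  refine lintegral_mono fun τ => ?_
  by_cases hτ : τ ∈ Set.Ioo (-σ) σ
  · rw [Set.indicator_of_mem hτ, Set.indicator_of_mem (show a + b * τ ∈ Set.Ioi 0 from hpos τ hτ)]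
    simp
  · rw [Set.indicator_of_notMem hτ]; exact zero_le

/-- The Laplace transform along a line segment that meets the imaginary axis transversally is
bounded on `L²`, by the Schur test with weight `y ^ (1 / 2)`. -/
theorem lintegral_laplace_sq_le {a b σ : ℝ} (hb : b ≠ 0)
    (hpos : ∀ τ ∈ Set.Ioo (-σ) σ, 0 < a + b * τ) {g : ℝ → ENNReal}
    (hg : AEMeasurable g (volume.restrict (Set.Ioo (-σ) σ))) :
    ∫⁻ x in Set.Iio (0 : ℝ), (∫⁻ τ in Set.Ioo (-σ) σ,
        ENNReal.ofReal (Real.exp (x * (a + b * τ))) * g τ) ^ 2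
      ≤ ENNReal.ofReal (|b⁻¹| * Real.pi) * ∫⁻ τ in Set.Ioo (-σ) σ, g τ ^ 2 := by
  set ν := volume.restrict (Set.Ioo (-σ) σ) with hν
  -- The integral in `τ` yields `|b⁻¹| √π`; the later integral in `x` contributes a second `√π`.
  obtain ⟨K, hK⟩ : ∃ K : ℝ, K = |b⁻¹| * Real.sqrt Real.pi := ⟨_, rfl⟩
  have hK0 : 0 ≤ K := hK ▸ by positivity
  have hmem : ∀ᵐ τ ∂ν, τ ∈ Set.Ioo (-σ) σ := ae_restrict_mem measurableSet_Ioo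
  have step : ∀ x ∈ Set.Iio (0 : ℝ),
      (∫⁻ τ, ENNReal.ofReal (Real.exp (x * (a + b * τ))) * g τ ∂ν) ^ 2
      ≤ ∫⁻ τ, ENNReal.ofReal (K * (-x) ^ (-1 / 2 : ℝ)) *
        (ENNReal.ofReal (Real.exp (x * (a + b * τ)) * (a + b * τ) ^ (1 / 2 : ℝ)) * g τ ^ 2)
          ∂ν := by
    intro x hx
    -- The kernel is split into two square roots weighted by `y ^ (∓1/4)`, `y = a + b τ`, ready for
    -- Cauchy-Schwarz.
    have e1 : ∀ᵐ τ ∂ν, ENNReal.ofReal (Real.exp (x * (a + b * τ))) * g τ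
        = ENNReal.ofReal (Real.exp (x * (a + b * τ) / 2) * (a + b * τ) ^ (-1 / 4 : ℝ)) *
          (ENNReal.ofReal (Real.exp (x * (a + b * τ) / 2) * (a + b * τ) ^ (1 / 4 : ℝ)) * g τ) := by
      filter_upwards [hmem] with τ hτ
      have hy := hpos τ hτ
      rw [← mul_assoc, ← ENNReal.ofReal_mul (by positivity)]
      congr 2
      rw [mul_mul_mul_comm, ← Real.exp_add, ← Real.rpow_add hy]
      norm_num
    rw [lintegral_congr_ae e1]
    refine (sq_lintegral_mul_le ν (by fun_prop) (by fun_prop)).trans ?_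
    rw [lintegral_const_mul'' _ (by fun_prop)]
    refine mul_le_mul' ?_ (le_of_eq ?_)
    · refine le_trans (le_of_eq ?_)
        ((lintegral_Ioo_rpow_neg_half_mul_exp_le hb hpos hx).trans (le_of_eq ?_))
      · refine lintegral_congr_ae ?_
        filter_upwards [hmem] with τ hτ
        have hy := hpos τ hτ
        rw [← ENNReal.ofReal_pow (by positivity), mul_pow, ← Real.exp_nat_mul,
          ← Real.rpow_mul_natCast hy.le]
        congr 3 <;> norm_num
        ring
      · rw [hK, mul_assoc]
    · refine lintegral_congr_ae ?_
      filter_upwards [hmem] with τ hτ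
      have hy := hpos τ hτ
      rw [mul_pow, ← ENNReal.ofReal_pow (by positivity), mul_pow, ← Real.exp_nat_mul,
        ← Real.rpow_mul_natCast hy.le]
      congr 3 <;> norm_num
      ring
  calc _ ≤ ∫⁻ x in Set.Iio (0 : ℝ), ∫⁻ τ, ENNReal.ofReal (K * (-x) ^ (-1 / 2 : ℝ)) *
        (ENNReal.ofReal (Real.exp (x * (a + b * τ)) * (a + b * τ) ^ (1 / 2 : ℝ)) * g τ ^ 2)
          ∂ν := setLIntegral_mono' measurableSet_Iio step
    _ = ∫⁻ τ, (∫⁻ x in Set.Iio (0 : ℝ), ENNReal.ofReal (K * (-x) ^ (-1 / 2 : ℝ)) *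
        (ENNReal.ofReal (Real.exp (x * (a + b * τ)) * (a + b * τ) ^ (1 / 2 : ℝ)) * g τ ^ 2))
          ∂ν := by
        refine lintegral_lintegral_swap ?_
        have h1 : AEMeasurable (fun p : ℝ × ℝ => g p.2)
            ((volume.restrict (Set.Iio (0 : ℝ))).prod ν) := hg.comp_snd
        refine AEMeasurable.mul (Measurable.aemeasurable (by fun_prop)) ?_
        exact AEMeasurable.mul (Measurable.aemeasurable (by fun_prop)) (h1.pow_const 2)
    _ = ∫⁻ τ, ENNReal.ofReal (|b⁻¹| * Real.pi) * g τ ^ 2 ∂ν := by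
        refine lintegral_congr_ae ?_
        filter_upwards [hmem] with τ hτ
        have hy := hpos τ hτ
        have e2 : ∀ x ∈ Set.Iio (0 : ℝ), ENNReal.ofReal (K * (-x) ^ (-1 / 2 : ℝ)) *
            (ENNReal.ofReal (Real.exp (x * (a + b * τ)) * (a + b * τ) ^ (1 / 2 : ℝ)) * g τ ^ 2)
            = (ENNReal.ofReal (K * (a + b * τ) ^ (1 / 2 : ℝ)) * g τ ^ 2) *
              ENNReal.ofReal (Real.exp (-((a + b * τ) * -x)) * (-x) ^ (-1 / 2 : ℝ)) := by
          intro x hx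
          have : 0 < -x := neg_pos.2 hx
          rw [mul_right_comm (ENNReal.ofReal (K * (a + b * τ) ^ (1 / 2 : ℝ))), ← mul_assoc,
            ← ENNReal.ofReal_mul (by positivity),
            ← ENNReal.ofReal_mul (by positivity)]
          congr 2
          rw [show -((a + b * τ) * -x) = x * (a + b * τ) by ring]
          ring
        rw [setLIntegral_congr_fun measurableSet_Iio e2, lintegral_const_mul _ (by fun_prop)]
        -- The same Gamma integral after `x ↦ -x`; its `y ^ (-1/2)` cancels the remaining weight `y
        -- ^ (1/2)`.
        have e3 : ∫⁻ x in Set.Iio (0 : ℝ),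
            ENNReal.ofReal (Real.exp (-((a + b * τ) * -x)) * (-x) ^ (-1 / 2 : ℝ))
            = ENNReal.ofReal (Real.sqrt Real.pi * (a + b * τ) ^ (-1 / 2 : ℝ)) := by
          rw [← lintegral_rpow_neg_half_mul_exp hy, ← lintegral_indicator measurableSet_Iio,
            ← lintegral_indicator measurableSet_Ioi, ← lintegral_neg_eq_self]
          congr 1
          ext x
          by_cases hx : 0 < x
          · rw [Set.indicator_of_mem (show -x ∈ Set.Iio (0 : ℝ) from neg_lt_zero.2 hx),
              Set.indicator_of_mem (show x ∈ Set.Ioi (0 : ℝ) from hx), neg_neg]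
          · rw [Set.indicator_of_notMem (show -x ∉ Set.Iio (0 : ℝ) by simpa using hx),
              Set.indicator_of_notMem (show x ∉ Set.Ioi (0 : ℝ) from hx)]
        rw [e3, mul_right_comm, ← ENNReal.ofReal_mul (by positivity)]
        congr 2
        rw [hK, mul_mul_mul_comm, mul_assoc |b⁻¹|, Real.mul_self_sqrt Real.pi_pos.le,
          ← Real.rpow_add hy]
        norm_num
    _ = _ := lintegral_const_mul'' _ (by fun_prop)

/-- For parallel sides the exponent does not depend on `τ`, so the substitution behind the Schur
test fails; but the variables separate and the height `a` is strictly positive. -/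
theorem lintegral_laplace_sq_le_of_const {a σ : ℝ} (ha : 0 < a) {g : ℝ → ENNReal}
    (hg : AEMeasurable g (volume.restrict (Set.Ioo (-σ) σ))) :
    ∫⁻ x in Set.Iio (0 : ℝ), (∫⁻ τ in Set.Ioo (-σ) σ,
        ENNReal.ofReal (Real.exp (x * a)) * g τ) ^ 2
      ≤ ENNReal.ofReal (2 * σ / (2 * a)) * ∫⁻ τ in Set.Ioo (-σ) σ, g τ ^ 2 := by
  have h1 : (∫⁻ τ in Set.Ioo (-σ) σ, g τ) ^ 2
      ≤ ENNReal.ofReal (2 * σ) * ∫⁻ τ in Set.Ioo (-σ) σ, g τ ^ 2 := by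
    have h := sq_lintegral_mul_le (volume.restrict (Set.Ioo (-σ) σ)) (f := fun _ => 1) (by fun_prop)
      hg
    simp only [one_mul, one_pow, lintegral_const, Measure.restrict_apply_univ,
      Real.volume_Ioo] at h
    rwa [show σ - -σ = 2 * σ by ring] at h
  have h2 : ∫⁻ x in Set.Iio (0 : ℝ), ENNReal.ofReal (Real.exp (x * a)) ^ 2
      = ENNReal.ofReal (1 / (2 * a)) := by
    have e : ∀ x : ℝ, ENNReal.ofReal (Real.exp (x * a)) ^ 2
        = ENNReal.ofReal (Real.exp (2 * a * x)) := fun x => by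
      rw [← ENNReal.ofReal_pow (Real.exp_nonneg _), ← Real.exp_nat_mul]; congr 2; push_cast; ring
    simp only [e]
    rw [setLIntegral_congr Iio_ae_eq_Iic, ← ofReal_integral_eq_lintegral_ofReal
      (integrableOn_exp_mul_Iic (by positivity) 0) (by filter_upwards with x; positivity),
      integral_exp_mul_Iic (by positivity)]
    simp
  calc _ = ∫⁻ x in Set.Iio (0 : ℝ), ENNReal.ofReal (Real.exp (x * a)) ^ 2 *
        (∫⁻ τ in Set.Ioo (-σ) σ, g τ) ^ 2 := by
        refine lintegral_congr fun x => ?_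
        rw [lintegral_const_mul'' _ hg, mul_pow]
    _ = ENNReal.ofReal (1 / (2 * a)) * (∫⁻ τ in Set.Ioo (-σ) σ, g τ) ^ 2 := by
        rw [lintegral_mul_const _ (by fun_prop), h2]
    _ ≤ _ := by
        refine (mul_le_mul_right h1 _).trans (le_of_eq ?_)
        rw [← mul_assoc, ← ENNReal.ofReal_mul (by positivity)]
        congr 2; ring

theorem exists_lintegral_laplace_sq_le {a b σ : ℝ} (hσ : 0 < σ)
    (hpos : ∀ τ ∈ Set.Ioo (-σ) σ, 0 < a + b * τ) :
    ∃ C : ℝ, 0 ≤ C ∧ ∀ g : ℝ → ENNReal, AEMeasurable g (volume.restrict (Set.Ioo (-σ) σ)) →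
      ∫⁻ x in Set.Iio (0 : ℝ), (∫⁻ τ in Set.Ioo (-σ) σ,
        ENNReal.ofReal (Real.exp (x * (a + b * τ))) * g τ) ^ 2
      ≤ ENNReal.ofReal C * ∫⁻ τ in Set.Ioo (-σ) σ, g τ ^ 2 := by
  rcases eq_or_ne b 0 with rfl | hb
  · have ha : 0 < a := by simpa using hpos 0 ⟨by linarith, hσ⟩
    exact ⟨2 * σ / (2 * a), by positivity, fun g hg => by
      simpa using lintegral_laplace_sq_le_of_const ha hg⟩
  · exact ⟨|b⁻¹| * Real.pi, by positivity, fun g hg => lintegral_laplace_sq_le hb hpos hg⟩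

/-! ### Boundedness of the global relation operator -/

namespace PWSym

variable {σ : ℝ}

/-- The element of `PW^σ_sym` with a given square integrable density. -/
def ofDensity (g : ℝ → ℝ) (hg : MemLp g 2 (volume.restrict (Set.Icc (-σ) σ))) : PWSym σ :=
  ⟨fourierOn σ g, g, hg, rfl⟩

theorem eval_ofDensity (g : ℝ → ℝ) (hg : MemLp g 2 (volume.restrict (Set.Icc (-σ) σ))) :
    (ofDensity g hg).eval = fourierOn σ g := rfl

theorem exists_density (f : PWSym σ) : ∃ (g : ℝ → ℝ)
    (hg : MemLp g 2 (volume.restrict (Set.Icc (-σ) σ))), f = ofDensity g hg := by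
  obtain ⟨f, g, hg, rfl⟩ := f
  exact ⟨g, hg, rfl⟩

theorem eval_add (f g : PWSym σ) (z : ℂ) : (f + g).eval z = f.eval z + g.eval z := rfl

theorem eval_smul (c : ℝ) (f : PWSym σ) (z : ℂ) : (c • f).eval z = c • f.eval z := rfl

theorem enorm_sq (f : PWSym σ) : ‖f‖ₑ ^ 2 = ∫⁻ x : ℝ, ‖f (x : ℂ)‖ₑ ^ 2 := by
  have h : ‖f‖ = ‖(memLp f).toLp _‖ := rfl
  rw [← eLpNorm_two_sq, ← Lp.enorm_toLp (memLp f), ← ofReal_norm, ← ofReal_norm, h]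

theorem enorm_ofDensity_sq {g : ℝ → ℝ} (hg : MemLp g 2 (volume.restrict (Set.Icc (-σ) σ))) :
    ‖ofDensity g hg‖ₑ ^ 2
      = ENNReal.ofReal (2 * Real.pi) * ∫⁻ τ in Set.Icc (-σ) σ, ‖g τ‖ₑ ^ 2 := by
  rw [enorm_sq, ← lintegral_enorm_fourierOn_sq hg]
  rfl

end PWSym

/-- A real linear family of square integrable functions that satisfies a norm bound defines a
bounded operator to `L²`. -/
theorem exists_continuousLinearMap {E α : Type*} [NormedAddCommGroup E] [NormedSpace ℝ E]
    [MeasurableSpace α] {μ : Measure α} (L : E → α → ℂ)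
    (hadd : ∀ f g x, L (f + g) x = L f x + L g x) (hsmul : ∀ (c : ℝ) f x, L (c • f) x = c • L f x)
    (hmeas : ∀ f, AEStronglyMeasurable (L f) μ) {C : ℝ}
    (hC : ∀ f, ∫⁻ x, ‖L f x‖ₑ ^ 2 ∂μ ≤ ENNReal.ofReal C * ‖f‖ₑ ^ 2) :
    ∃ T : E →L[ℝ] Lp ℂ 2 μ, ∀ f, T f =ᵐ[μ] L f := by
  have hb : ∀ f, eLpNorm (L f) 2 μ ≤ ENNReal.ofReal (Real.sqrt C * ‖f‖) := by
    intro f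
    rw [← ENNReal.pow_le_pow_left_iff two_ne_zero, eLpNorm_two_sq]
    refine (hC f).trans (le_of_eq ?_)
    rw [ENNReal.ofReal_mul (by positivity), mul_pow, ofReal_norm, ← ENNReal.ofReal_pow
      (by positivity)]
    congr 1
    -- No sign of `C` is assumed: for `C ≤ 0` both `Real.sqrt` and `ENNReal.ofReal` return zero.
    rcases le_total 0 C with h | h
    · rw [Real.sq_sqrt h]
    · rw [Real.sqrt_eq_zero_of_nonpos h, ENNReal.ofReal_of_nonpos h]; simp
  have hm : ∀ f, MemLp (L f) 2 μ := fun f =>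
    ⟨hmeas f, (hb f).trans_lt ENNReal.ofReal_lt_top⟩
  have e1 : ∀ f g, L (f + g) = L f + L g := fun f g => funext (hadd f g)
  have e2 : ∀ (c : ℝ) f, L (c • f) = c • L f := fun c f => funext (hsmul c f)
  let T₀ : E →ₗ[ℝ] Lp ℂ 2 μ :=
    { toFun := fun f => (hm f).toLp _
      map_add' := fun f g => by
        rw [← MemLp.toLp_add]
        exact MemLp.toLp_congr _ _ (by rw [e1])
      map_smul' := fun c f => by
        rw [RingHom.id_apply, ← MemLp.toLp_const_smul]
        exact MemLp.toLp_congr _ _ (by rw [e2]) }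
  refine ⟨T₀.mkContinuous (Real.sqrt C) fun f => ?_, fun f => (hm f).coeFn_toLp⟩
  change ‖(hm f).toLp _‖ ≤ _
  rw [Lp.norm_toLp]
  exact ENNReal.toReal_le_of_le_ofReal (by positivity) (hb f)

/-- The contribution of the side `j` to the component `i` of the global relation. -/
def sideTerm {n : ℕ} (P : Polygon ℂ n) (i j : Fin n) (f : ℂ → ℂ) (z : ℂ) : ℂ :=
  exp (I * exp (-I * (sideAngle P i : ℂ)) * (sideMid P i - sideMid P j) * z) *
    f (exp (-I * ((sideAngle P i - sideAngle P j : ℝ) : ℂ)) * z)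

variable {n : ℕ} {P : Polygon ℂ n}

theorem sideTerm_self (i : Fin n) (f : ℂ → ℂ) (z : ℂ) : sideTerm P i i f z = f z := by
  simp [sideTerm]

theorem globalRelation_eq_sum (Φ : XSym P) (i : Fin n) (z : ℂ) :
    globalRelation P Φ i z = ∑ j, sideTerm P i j (Φ j) z := by
  rw [← Finset.add_sum_erase _ _ (Finset.mem_univ i), sideTerm_self]
  rfl

/-- The prefactor supplies the translation by the midpoints and the rotated argument supplies the
direction of side `j`; together they form the coordinate relative to side `i` of a point on side
`j`. -/
theorem sideTerm_fourierOn (i j : Fin n) (σ : ℝ) (g : ℝ → ℝ) (z : ℂ) :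
    sideTerm P i j (fourierOn σ g) z = ∫ τ in Set.Icc (-σ) σ,
      exp (-I * z * sideCoord P i (sidePoint P j τ)) * (g τ : ℂ) := by
  rw [sideTerm, fourierOn, ← integral_const_mul]
  congr 1
  ext τ
  rw [← mul_assoc, ← exp_add]
  congr 2
  have e : exp (-I * ((sideAngle P i - sideAngle P j : ℝ) : ℂ))
      = exp (-I * (sideAngle P i : ℂ)) * sideDir P j := by
    rw [sideDir, ← exp_add]; congr 1; push_cast; ring
  rw [e, sideCoord, sidePoint]
  ring

theorem norm_exp_neg_I_mul (x : ℝ) (w : ℂ) : ‖exp (-I * x * w)‖ = Real.exp (x * w.im) := by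
  rw [norm_exp]
  simp

theorem aestronglyMeasurable_sideTerm (i j : Fin n) {σ : ℝ} {g : ℝ → ℝ}
    (hg : MemLp g 2 (volume.restrict (Set.Icc (-σ) σ))) (μ : Measure ℝ) [SFinite μ] :
    AEStronglyMeasurable (fun x : ℝ => sideTerm P i j (fourierOn σ g) x) μ := by
  simp only [sideTerm_fourierOn]
  refine AEStronglyMeasurable.integral_prod_right' (μ := μ)
    (f := fun p : ℝ × ℝ => exp (-I * p.1 * sideCoord P i (sidePoint P j p.2)) * (g p.2 : ℂ)) ?_
  refine AEStronglyMeasurable.mul (Continuous.aestronglyMeasurable ?_) ?_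
  · unfold sideCoord sidePoint; fun_prop
  · exact (continuous_ofReal.comp_aestronglyMeasurable hg.1).comp_snd

theorem IsConvexPolygon.exists_lintegral_sideTerm_sq_le (hP : IsConvexPolygon P) (i j : Fin n) :
    ∃ C : ℝ, ∀ f : PWSym (halfLength P j),
      ∫⁻ x in Set.Iio (0 : ℝ), ‖sideTerm P i j f x‖ₑ ^ 2 ≤ ENNReal.ofReal C * ‖f‖ₑ ^ 2 := by
  rcases eq_or_ne j i with rfl | hij
  · refine ⟨1, fun f => ?_⟩
    simp only [sideTerm_self, ENNReal.ofReal_one, one_mul, PWSym.enorm_sq]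
    exact setLIntegral_le_lintegral _ _
  have hσ := hP.halfLength_pos j
  obtain ⟨a, b, hab⟩ : ∃ a b : ℝ, ∀ τ : ℝ,
      (sideCoord P i (sidePoint P j τ)).im = a + b * τ :=
    ⟨((sideCoord P i (P j)).im + (sideCoord P i (P (finRotate n j))).im) / 2,
      ((sideCoord P i (P (finRotate n j))).im - (sideCoord P i (P j)).im) / 2 / halfLength P j,
      fun τ => by rw [hP.im_sideCoord_sidePoint]; ring⟩
  obtain ⟨C, hC0, hC⟩ := exists_lintegral_laplace_sq_le (a := a) (b := b) hσ fun τ hτ => by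
    rw [← hab]; exact hP.im_sideCoord_sidePoint_pos hij hτ
  refine ⟨C / (2 * Real.pi), fun f => ?_⟩
  obtain ⟨g, hg, rfl⟩ := f.exists_density
  have hg' : AEMeasurable (fun τ => ‖g τ‖ₑ)
      (volume.restrict (Set.Ioo (-halfLength P j) (halfLength P j))) :=
    hg.1.enorm.mono_measure (Measure.restrict_mono Set.Ioo_subset_Icc_self le_rfl)
  rw [PWSym.enorm_ofDensity_sq, ← mul_assoc, ← ENNReal.ofReal_mul (by positivity),
    div_mul_cancel₀ _ (by positivity), ← setLIntegral_congr Ioo_ae_eq_Icc]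
  refine le_trans (lintegral_mono fun x => ?_) (hC _ hg')
  refine pow_le_pow_left₀ zero_le ?_ 2
  rw [PWSym.eval_ofDensity, sideTerm_fourierOn]
  refine (enorm_integral_le_lintegral_enorm _).trans (le_of_eq ?_)
  rw [← setLIntegral_congr Ioo_ae_eq_Icc]
  refine lintegral_congr fun τ => ?_
  rw [enorm_mul, ← ofReal_norm (exp _), norm_exp_neg_I_mul, hab]
  simp [enorm_eq_nnnorm]

theorem IsConvexPolygon.exists_operator (hP : IsConvexPolygon P) :
    ∃ T : XSym P →L[ℝ] YSpace n, ∀ (Φ : XSym P) (i : Fin n),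
      (T Φ i : ℝ → ℂ) =ᵐ[volume.restrict (Set.Iio (0 : ℝ))]
        fun x : ℝ => globalRelation P Φ i (x : ℂ) := by
  have h : ∀ i j : Fin n, ∃ S : PWSym (halfLength P j) →L[ℝ]
      Lp ℂ 2 (volume.restrict (Set.Iio (0 : ℝ))), ∀ f,
      S f =ᵐ[volume.restrict (Set.Iio (0 : ℝ))] fun x : ℝ => sideTerm P i j f x := by
    intro i j
    obtain ⟨C, hC⟩ := hP.exists_lintegral_sideTerm_sq_le i j
    refine exists_continuousLinearMap (fun (f : PWSym (halfLength P j)) x => sideTerm P i j f (x : ℝ))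
      (fun f g x => ?_) (fun c f x => ?_) (fun f => ?_) hC
    · simp only [sideTerm, PWSym.eval_add]; ring
    · simp only [sideTerm, PWSym.eval_smul, real_smul]; ring
    · obtain ⟨g, hg, rfl⟩ := f.exists_density
      exact aestronglyMeasurable_sideTerm i j hg _
  choose S hS using h
  refine ⟨(PiLp.continuousLinearEquiv 2 ℝ _).symm.toContinuousLinearMap.comp
    (ContinuousLinearMap.pi fun i => ∑ j, (S i j).comp
      ((PiLp.proj 2 (𝕜 := ℝ) (fun j : Fin n => PWSym (halfLength P j)) j))), fun Φ i => ?_⟩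
  have e : (((PiLp.continuousLinearEquiv 2 ℝ _).symm.toContinuousLinearMap.comp
      (ContinuousLinearMap.pi fun i => ∑ j, (S i j).comp
      (PiLp.proj 2 (𝕜 := ℝ) (fun j : Fin n => PWSym (halfLength P j)) j))) Φ : YSpace n) i
      = ∑ j, S i j (Φ j) := by
    simp
  rw [e]
  have h1 := Lp.coeFn_finsetSum Finset.univ (fun j => S i j (Φ j))
  have h2 : ∀ᵐ x ∂(volume.restrict (Set.Iio (0 : ℝ))), ∀ j,
      S i j (Φ j) x = sideTerm P i j (Φ j) (x : ℝ) := ae_all_iff.2 fun j => hS i j (Φ j)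
  filter_upwards [h1, h2] with x hx1 hx2
  rw [globalRelation_eq_sum, hx1, Finset.sum_apply]
  exact Finset.sum_congr rfl fun j _ => hx2 j

/-! ### Smooth densities supported in the open side -/

/-- Smooth functions with support in the open interval `(-σ, σ)`. -/
def IsTestDensity (σ : ℝ) (φ : ℝ → ℝ) : Prop :=
  ContDiff ℝ (⊤ : ℕ∞) φ ∧ tsupport φ ⊆ Set.Ioo (-σ) σ

namespace IsTestDensity

variable {σ : ℝ} {φ ψ : ℝ → ℝ}

theorem hasCompactSupport (h : IsTestDensity σ φ) : HasCompactSupport φ :=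
  isCompact_Icc.of_isClosed_subset (isClosed_tsupport φ) (h.2.trans Set.Ioo_subset_Icc_self)

theorem memLp (h : IsTestDensity σ φ) (μ : Measure ℝ) [IsFiniteMeasureOnCompacts μ] :
    MemLp φ 2 μ := h.1.continuous.memLp_of_hasCompactSupport h.hasCompactSupport

theorem zero (σ : ℝ) : IsTestDensity σ 0 :=
  ⟨contDiff_const, by simp [tsupport]⟩

theorem add (hφ : IsTestDensity σ φ) (hψ : IsTestDensity σ ψ) : IsTestDensity σ (φ + ψ) :=
  ⟨hφ.1.add hψ.1, (tsupport_add φ ψ).trans (Set.union_subset hφ.2 hψ.2)⟩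

theorem smul (c : ℝ) (hφ : IsTestDensity σ φ) : IsTestDensity σ (c • φ) :=
  ⟨contDiff_const.smul hφ.1, (closure_mono (Function.support_const_smul_subset c φ)).trans hφ.2⟩

theorem eq_zero_of_notMem (h : IsTestDensity σ φ) {τ : ℝ} (hτ : τ ∉ Set.Ioo (-σ) σ) : φ τ = 0 :=
  image_eq_zero_of_notMem_tsupport fun h' => hτ (h.2 h')

/-- A continuous function that is positive on `(-σ, σ)` is bounded below on the support. -/
theorem exists_le (h : IsTestDensity σ φ) {f : ℝ → ℝ} (hf : Continuous f)
    (hpos : ∀ τ ∈ Set.Ioo (-σ) σ, 0 < f τ) : ∃ δ > 0, ∀ τ, φ τ ≠ 0 → δ ≤ f τ := by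
  rcases (tsupport φ).eq_empty_or_nonempty with he | hne
  · refine ⟨1, one_pos, fun τ hτ => absurd (subset_tsupport φ hτ) (by simp [he])⟩
  · obtain ⟨τ₀, h0, hmin⟩ := h.hasCompactSupport.isCompact.exists_isMinOn hne hf.continuousOn
    exact ⟨f τ₀, hpos _ (h.2 h0), fun τ hτ => hmin (subset_tsupport φ hτ)⟩

/-- A test density as a Schwartz function. -/
def toSchwartz (h : IsTestDensity σ φ) : SchwartzMap ℝ ℂ :=
  (h.hasCompactSupport.comp_left (g := ofReal) (by simp)).toSchwartzMap
    (ofRealCLM.contDiff.comp h.1)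

theorem toSchwartz_apply (h : IsTestDensity σ φ) (x : ℝ) : h.toSchwartz x = (φ x : ℂ) := rfl

theorem extend_eq (h : IsTestDensity σ φ) : PWSym.extend σ φ = h.toSchwartz := by
  ext τ
  rw [PWSym.extend, toSchwartz_apply]
  by_cases hτ : τ ∈ Set.Icc (-σ) σ
  · rw [Set.indicator_of_mem hτ]
  · rw [Set.indicator_of_notMem hτ,
      h.eq_zero_of_notMem fun h' => hτ (Set.Ioo_subset_Icc_self h'), ofReal_zero]

theorem fourierOn_eq (h : IsTestDensity σ φ) (x : ℝ) : fourierOn σ φ x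
    = (FourierTransform.fourier h.toSchwartz : SchwartzMap ℝ ℂ) ((2 * Real.pi)⁻¹ * x) := by
  rw [PWSym.fourierOn_eq, h.extend_eq, SchwartzMap.fourier_coe]

theorem integrable_fourierOn (h : IsTestDensity σ φ) :
    Integrable fun x : ℝ => fourierOn σ φ x := by
  simp only [h.fourierOn_eq]
  exact (SchwartzMap.integrable _).comp_mul_left' (by positivity)

theorem integrable_mul_fourierOn (h : IsTestDensity σ φ) :
    Integrable fun x : ℝ => ‖x‖ * ‖fourierOn σ φ x‖ := by
  have h1 := (((FourierTransform.fourier h.toSchwartz : SchwartzMap ℝ ℂ).integrable_pow_mul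
    volume 1).comp_mul_left' (R := (2 * Real.pi)⁻¹) (by positivity)).const_mul (2 * Real.pi)
  refine h1.congr (Filter.Eventually.of_forall fun x => ?_)
  simp only [h.fourierOn_eq]
  rw [norm_mul, Real.norm_of_nonneg (by positivity : 0 ≤ (2 * Real.pi)⁻¹)]
  field_simp

/-- Fourier inversion. -/
theorem fourier_inversion (h : IsTestDensity σ φ) (s : ℝ) :
    ∫ x : ℝ, exp (I * x * s) * fourierOn σ φ x = 2 * Real.pi * φ s := by
  have h1 : FourierTransformInv.fourierInv
      (FourierTransform.fourier (h.toSchwartz : ℝ → ℂ)) s = h.toSchwartz s := by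
    rw [h.toSchwartz.continuous.fourierInv_fourier_eq h.toSchwartz.integrable
      (by rw [← SchwartzMap.fourier_coe]; exact SchwartzMap.integrable _)]
  rw [Real.fourierInv_eq', toSchwartz_apply, ← SchwartzMap.fourier_coe] at h1
  rw [← h1, ← ofReal_ofNat, ← ofReal_mul, ← real_smul]
  have h2 := Measure.integral_comp_mul_left (fun v : ℝ =>
    exp ((2 * Real.pi * inner ℝ v s : ℝ) * I) •
      (FourierTransform.fourier h.toSchwartz : SchwartzMap ℝ ℂ) v) (2 * Real.pi)⁻¹
  rw [inv_inv, abs_of_pos (by positivity)] at h2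
  rw [← h2]
  congr 1
  ext x
  rw [h.fourierOn_eq, smul_eq_mul]
  congr 2
  have : (Real.pi : ℂ) ≠ 0 := by exact_mod_cast Real.pi_ne_zero
  simp only [RCLike.inner_apply, conj_trivial]
  push_cast
  field_simp

end IsTestDensity

/-- Test densities are dense in `L²`. -/
theorem exists_isTestDensity_eLpNorm_sub_lt {σ : ℝ} {g : ℝ → ℝ}
    (hg : MemLp g 2 (volume.restrict (Set.Icc (-σ) σ))) {ε : ENNReal} (hε : 0 < ε) :
    ∃ φ, IsTestDensity σ φ ∧ eLpNorm (g - φ) 2 (volume.restrict (Set.Icc (-σ) σ)) < ε := by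
  set ν := volume.restrict (Set.Icc (-σ) σ) with hν
  let S : Submodule ℝ (Lp ℝ 2 ν) :=
    { carrier := {u | ∃ φ, IsTestDensity σ φ ∧ u =ᵐ[ν] φ}
      zero_mem' := ⟨0, .zero σ, Lp.coeFn_zero _ _ _⟩
      add_mem' := by
        rintro u v ⟨φ, hφ, hu⟩ ⟨ψ, hψ, hv⟩
        exact ⟨φ + ψ, hφ.add hψ, (Lp.coeFn_add u v).trans (hu.add hv)⟩
      smul_mem' := by
        rintro c u ⟨φ, hφ, hu⟩
        exact ⟨c • φ, hφ.smul c, (Lp.coeFn_smul c u).trans (hu.const_smul c)⟩ }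
  -- The orthogonal complement is trivial: a function orthogonal to all test functions vanishes a.e.
  -- on the open interval, and the end points are null.
  have hS : S.topologicalClosure = ⊤ := by
    rw [Submodule.topologicalClosure_eq_top_iff, Submodule.eq_bot_iff]
    intro u hu
    have hz : ∀ᵐ x : ℝ, x ∈ Set.Ioo (-σ) σ → u x = 0 := by
      refine isOpen_Ioo.ae_eq_zero_of_integral_contDiff_smul_eq_zero ?_ ?_
      · have h1 : IntegrableOn u (Set.Icc (-σ) σ) volume :=
          (Lp.memLp u).integrable (by norm_num)
        exact (h1.mono_set Set.Ioo_subset_Icc_self).locallyIntegrableOn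
      · intro φ hφ _ hs
        have ht : IsTestDensity σ φ := ⟨hφ, hs⟩
        have h1 := (Submodule.mem_orthogonal S u).1 hu ((ht.memLp ν).toLp φ)
          ⟨φ, ht, (ht.memLp ν).coeFn_toLp⟩
        rw [L2.inner_def] at h1
        rw [← setIntegral_eq_integral_of_forall_compl_eq_zero (s := Set.Icc (-σ) σ), ← h1]
        · refine integral_congr_ae ?_
          filter_upwards [(ht.memLp ν).coeFn_toLp] with x hx
          rw [hx]
          simp [mul_comm]
        · intro x hx
          rw [ht.eq_zero_of_notMem fun h' => hx (Set.Ioo_subset_Icc_self h'), zero_smul]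
    rw [Lp.eq_zero_iff_ae_eq_zero]
    have h1 := (ae_restrict_iff' measurableSet_Ioo).2 hz
    rwa [Measure.restrict_congr_set Ioo_ae_eq_Icc] at h1
  have hmem : hg.toLp g ∈ closure (S : Set (Lp ℝ 2 ν)) := by
    rw [← Submodule.topologicalClosure_coe, hS]; trivial
  obtain ⟨u, ⟨φ, hφ, hu⟩, hlt⟩ := EMetric.mem_closure_iff.1 hmem ε hε
  refine ⟨φ, hφ, ?_⟩
  rw [← Lp.toLp_coeFn u (Lp.memLp u), Lp.edist_toLp_toLp] at hlt
  refine lt_of_eq_of_lt (eLpNorm_congr_ae ?_) hlt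
  filter_upwards [hu] with x hx
  simp [hx]

/-- Test densities are dense in `PW^σ_sym`. -/
theorem PWSym.dense_testDensity (σ : ℝ) :
    Dense {f : PWSym σ | ∃ φ, ∃ h : IsTestDensity σ φ, f = ofDensity φ (h.memLp _)} := by
  intro f
  rw [EMetric.mem_closure_iff]
  intro ε hε
  obtain ⟨g, hg, rfl⟩ := f.exists_density
  have hc : 0 < Real.sqrt (2 * Real.pi) := by positivity
  -- The transform multiplies norms by `√(2π)`, hence the tolerance `ε / √(2π)` for the densities.
  obtain ⟨φ, hφ, hlt⟩ := exists_isTestDensity_eLpNorm_sub_lt hg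
    (ENNReal.div_pos hε.ne' (ENNReal.ofReal_ne_top (r := Real.sqrt (2 * Real.pi))))
  refine ⟨_, ⟨φ, hφ, rfl⟩, ?_⟩
  rw [edist_eq_enorm_sub]
  have e : ofDensity g hg - ofDensity φ (hφ.memLp _)
      = ofDensity (g - φ) (hg.sub (hφ.memLp _)) := by
    rw [sub_eq_iff_eq_add]
    apply Subtype.ext
    ext z
    change fourierOn σ g z = fourierOn σ (g - φ) z + fourierOn σ φ z
    simp only [fourierOn]
    rw [← integral_add (integrable_aux (hg.sub (hφ.memLp _)) z) (integrable_aux (hφ.memLp _) z)]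
    congr 1; ext τ; simp; ring
  have e2 : ‖ofDensity (g - φ) (hg.sub (hφ.memLp _))‖ₑ
      = ENNReal.ofReal (Real.sqrt (2 * Real.pi)) *
        eLpNorm (g - φ) 2 (volume.restrict (Set.Icc (-σ) σ)) := by
    refine (ENNReal.pow_right_strictMono two_ne_zero).injective ?_
    rw [enorm_ofDensity_sq, mul_pow, eLpNorm_two_sq,
      ← ENNReal.ofReal_pow hc.le, Real.sq_sqrt (by positivity)]
  rw [e, e2, mul_comm]
  exact (ENNReal.lt_div_iff_mul_lt (.inl (by simpa using hc)) (.inl ENNReal.ofReal_ne_top)).1 hlt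

/-! ### Fourier integrals over half lines -/

/-- The Fourier integral over the positive half line, for frequencies in the closed upper half
plane. -/
def halfLineTransform (Φ : ℝ → ℂ) (w : ℂ) : ℂ := ∫ x in Set.Ioi (0 : ℝ), exp (I * x * w) * Φ x

theorem norm_exp_I_mul_le {x : ℝ} (hx : 0 < x) {w : ℂ} (hw : 0 ≤ w.im) :
    ‖exp (I * x * w)‖ ≤ 1 := by
  rw [norm_exp, Real.exp_le_one_iff]
  simpa using mul_nonneg hx.le hw

/-- On the closed half plane the exponential is bounded by `1`, so `‖Φ‖` dominates. Including the
real axis makes the interior field continuous up to the sides and vertices. -/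
theorem continuousOn_halfLineTransform {Φ : ℝ → ℂ} (h : Integrable Φ) :
    ContinuousOn (halfLineTransform Φ) {w | 0 ≤ w.im} := by
  unfold halfLineTransform
  refine continuousOn_of_dominated (bound := fun x => ‖Φ x‖) (fun w _ => ?_) (fun w hw => ?_)
    h.norm.integrableOn ?_
  · exact (Continuous.aestronglyMeasurable (by fun_prop)).mul h.1.restrict
  · filter_upwards [ae_restrict_mem measurableSet_Ioi] with x hx
    rw [norm_mul]
    exact mul_le_of_le_one_left (norm_nonneg _) (norm_exp_I_mul_le hx hw)
  · filter_upwards with x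
    fun_prop

theorem differentiableOn_halfLineTransform {Φ : ℝ → ℂ} (h : Integrable Φ)
    (h' : Integrable fun x : ℝ => ‖x‖ * ‖Φ x‖) :
    DifferentiableOn ℂ (halfLineTransform Φ) {w | 0 < w.im} := by
  intro w hw
  have ho : IsOpen {w : ℂ | 0 < w.im} := isOpen_lt continuous_const continuous_im
  have := hasDerivAt_integral_of_dominated_loc_of_deriv_le (𝕜 := ℂ)
    (μ := volume.restrict (Set.Ioi (0 : ℝ))) (F := fun w x => exp (I * x * w) * Φ x)
    (F' := fun w x => exp (I * x * w) * (I * x) * Φ x) (bound := fun x : ℝ => ‖x‖ * ‖Φ x‖)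
    (ho.mem_nhds hw) ?_ ?_ ?_ ?_ h'.integrableOn ?_
  · exact this.2.differentiableAt.differentiableWithinAt
  · filter_upwards with w
    exact (Continuous.aestronglyMeasurable (by fun_prop)).mul h.1.restrict
  · refine Integrable.mono h.integrableOn
      ((Continuous.aestronglyMeasurable (by fun_prop)).mul h.1.restrict) ?_
    filter_upwards [ae_restrict_mem measurableSet_Ioi] with x hx
    rw [norm_mul]
    exact mul_le_of_le_one_left (norm_nonneg _) (norm_exp_I_mul_le hx (le_of_lt hw))
  · exact (Continuous.aestronglyMeasurable (by fun_prop)).mul h.1.restrict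
  · filter_upwards [ae_restrict_mem measurableSet_Ioi] with x hx w hw
    rw [norm_mul, norm_mul, norm_mul, norm_I, one_mul, norm_real]
    exact mul_le_mul_of_nonneg_right (mul_le_of_le_one_left (norm_nonneg _)
      (norm_exp_I_mul_le hx (le_of_lt hw))) (norm_nonneg _)
  · filter_upwards with x w _
    have h1 : HasDerivAt (fun w : ℂ => I * x * w) (I * x) w := by
      simpa using (hasDerivAt_id w).const_mul (I * (x : ℂ))
    exact h1.cexp.mul_const _

/-- The Fourier-Laplace transform of a superposition of exponentials is the corresponding
superposition of simple fractions. -/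
theorem integral_Iio_integral_exp {μ : Measure ℝ} [SFinite μ] {φ θ : ℝ → ℂ} (hθ : Measurable θ)
    (hφ : Integrable φ μ) {δ : ℝ} (hδ : 0 < δ) (h : ∀ τ, φ τ ≠ 0 → δ ≤ (θ τ).im) :
    IntegrableOn (fun x : ℝ => ∫ τ, exp (-I * x * θ τ) * φ τ ∂μ) (Set.Iio 0) ∧
    ∫ x in Set.Iio (0 : ℝ), ∫ τ, exp (-I * x * θ τ) * φ τ ∂μ = ∫ τ, I / θ τ * φ τ ∂μ := by
  have hi : Integrable (fun p : ℝ × ℝ => exp (-I * p.1 * θ p.2) * φ p.2)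
      ((volume.restrict (Set.Iio (0 : ℝ))).prod μ) := by
    -- The uniform gap `δ` provides a product majorant, which justifies Fubini.
    have hb : Integrable (fun p : ℝ × ℝ => Real.exp (δ * p.1) * ‖φ p.2‖)
        ((volume.restrict (Set.Iio (0 : ℝ))).prod μ) :=
      Integrable.mul_prod (f := fun x : ℝ => Real.exp (δ * x)) (g := fun τ => ‖φ τ‖)
        ((integrableOn_exp_mul_Iic hδ 0).mono_set Set.Iio_subset_Iic_self) hφ.norm
    refine hb.mono' ?_ ?_
    · refine AEStronglyMeasurable.mul (Measurable.aestronglyMeasurable ?_) hφ.1.comp_snd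
      fun_prop
    · have hm : ∀ᵐ p ∂((volume.restrict (Set.Iio (0 : ℝ))).prod μ), p.1 ∈ Set.Iio (0 : ℝ) :=
        Measure.quasiMeasurePreserving_fst.ae (ae_restrict_mem measurableSet_Iio)
      filter_upwards [hm] with p hp
      rw [norm_mul]
      rcases eq_or_ne (φ p.2) 0 with h0 | h0
      · simp [h0]
      · rw [norm_exp_neg_I_mul]
        refine mul_le_mul_of_nonneg_right (Real.exp_le_exp.2 ?_) (norm_nonneg _)
        have hp' : p.1 < 0 := hp
        nlinarith [h _ h0]
  refine ⟨hi.integral_prod_left, ?_⟩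
  rw [integral_integral_swap hi]
  congr 1
  ext τ
  rw [integral_mul_const]
  rcases eq_or_ne (φ τ) 0 with h0 | h0
  · simp [h0]
  · congr 1
    have him : 0 < (θ τ).im := hδ.trans_le (h τ h0)
    have hre : 0 < (-I * θ τ).re := by simpa using him
    have hθ0 : θ τ ≠ 0 := fun h => by simp [h] at him
    have := integral_exp_mul_complex_Iic hre 0
    rw [← integral_Iic_eq_integral_Iio]
    rw [show (fun x : ℝ => exp (-I * x * θ τ)) = fun x : ℝ => exp (-I * θ τ * x) from
      funext fun x => by ring_nf, this]
    simp only [ofReal_zero, mul_zero, exp_zero]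
    rw [neg_mul, div_neg, div_mul_eq_div_div, one_div, inv_I]
    ring

/-! ### The field inside the polygon generated by smooth densities -/

/-- The Cauchy integral of the densities, inside the polygon. -/
def interiorField (P : Polygon ℂ n) (φ : Fin n → ℝ → ℝ) (z : ℂ) : ℂ :=
  ∑ j, (2 * Real.pi : ℂ)⁻¹ * (sideDir P j)⁻¹ *
    halfLineTransform (fun x : ℝ => fourierOn (halfLength P j) (φ j) x) (sideCoord P j z)

/-- The component `i` of the global relation, for given densities. -/
def densityRelation (P : Polygon ℂ n) (φ : Fin n → ℝ → ℝ) (i : Fin n) (x : ℝ) : ℂ :=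
  ∑ j, sideTerm P i j (fourierOn (halfLength P j) (φ j)) x

/-- The inverse Fourier transform of the restriction of the component `i` of the global relation to
the negative half line: minus the tangential trace of the exterior Cauchy integral on the
side `i`. -/
def exteriorTrace (P : Polygon ℂ n) (φ : Fin n → ℝ → ℝ) (i : Fin n) (s : ℝ) : ℂ :=
  (2 * Real.pi : ℂ)⁻¹ * ∫ x in Set.Iio (0 : ℝ), exp (I * x * s) * densityRelation P φ i x

theorem continuousOn_interiorField {φ : Fin n → ℝ → ℝ}
    (hφ : ∀ i, IsTestDensity (halfLength P i) (φ i)) :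
    ContinuousOn (interiorField P φ) {z | ∀ i, 0 ≤ (sideCoord P i z).im} := by
  unfold interiorField
  refine continuousOn_finsetSum _ fun j _ => continuousOn_const.mul ?_
  exact (continuousOn_halfLineTransform (hφ j).integrable_fourierOn).comp
    (continuous_sideCoord j).continuousOn fun z hz => hz j

theorem differentiableOn_interiorField {φ : Fin n → ℝ → ℝ}
    (hφ : ∀ i, IsTestDensity (halfLength P i) (φ i)) :
    DifferentiableOn ℂ (interiorField P φ) {z | ∀ i, 0 < (sideCoord P i z).im} := by
  unfold interiorField
  refine DifferentiableOn.fun_sum fun j _ => DifferentiableOn.const_mul ?_ _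
  exact (differentiableOn_halfLineTransform (hφ j).integrable_fourierOn
    (hφ j).integrable_mul_fourierOn).comp
    (differentiable_sideCoord j).differentiableOn fun z hz => hz j

/-- After `x ↦ -x` this is `integral_Iio_integral_exp` with `θ τ = w - τ`; as `τ` is real, the gap
is `δ = w.im`. -/
theorem halfLineTransform_fourierOn {σ : ℝ} {φ : ℝ → ℝ} (hφ : IsTestDensity σ φ) {w : ℂ}
    (hw : 0 < w.im) : halfLineTransform (fun x : ℝ => fourierOn σ φ x) w
      = ∫ τ in Set.Icc (-σ) σ, I / (w - τ) * (φ τ : ℂ) := by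
  have hint : Integrable (fun τ => (φ τ : ℂ)) (volume.restrict (Set.Icc (-σ) σ)) :=
    ((hφ.memLp _).integrable (by norm_num)).ofReal
  rw [← (integral_Iio_integral_exp (θ := fun τ => w - τ) (by fun_prop) hint hw
    (fun τ _ => by simp)).2, halfLineTransform]
  have h := integral_comp_neg_Iic 0 fun x : ℝ => exp (I * x * w) * fourierOn σ φ x
  rw [neg_zero, integral_Iic_eq_integral_Iio] at h
  rw [← h]
  congr 1
  ext x
  rw [fourierOn, ← integral_const_mul]
  congr 1
  ext τ
  rw [← mul_assoc, ← exp_add]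
  congr 2
  push_cast
  ring

theorem integral_exp_mul_sideTerm (hP : IsConvexPolygon P) {i j : Fin n} (hij : j ≠ i)
    {φ : ℝ → ℝ} (hφ : IsTestDensity (halfLength P j) φ) (s : ℝ) :
    IntegrableOn (fun x : ℝ => exp (I * x * s) * sideTerm P i j (fourierOn (halfLength P j) φ) x)
      (Set.Iio 0) ∧
    ∫ x in Set.Iio (0 : ℝ), exp (I * x * s) * sideTerm P i j (fourierOn (halfLength P j) φ) x
      = ∫ τ in Set.Icc (-halfLength P j) (halfLength P j),
          I / (sideCoord P i (sidePoint P j τ) - s) * (φ τ : ℂ) := by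
  have hint : Integrable (fun τ => (φ τ : ℂ))
      (volume.restrict (Set.Icc (-halfLength P j) (halfLength P j))) :=
    ((hφ.memLp _).integrable (by norm_num)).ofReal
  have hc : Continuous fun τ => sideCoord P i (sidePoint P j τ) :=
    (continuous_sideCoord i).comp (continuous_sidePoint j)
  -- Side `j` may touch side `i` at a vertex; the compact support of `φ` inside the open side keeps
  -- the height above side `i` away from zero.
  obtain ⟨δ, hδ, h⟩ := hφ.exists_le (continuous_im.comp hc)
    fun τ hτ => hP.im_sideCoord_sidePoint_pos hij hτ
  have key := integral_Iio_integral_exp (θ := fun τ => sideCoord P i (sidePoint P j τ) - s)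
    (hc.measurable.sub_const _) hint hδ (fun τ hτ => by
      simpa using h τ (by simpa using hτ))
  have e : (fun x : ℝ => exp (I * x * s) * sideTerm P i j (fourierOn (halfLength P j) φ) x)
      = fun x : ℝ => ∫ τ in Set.Icc (-halfLength P j) (halfLength P j),
        exp (-I * x * (sideCoord P i (sidePoint P j τ) - s)) * (φ τ : ℂ) := by
    ext x
    rw [sideTerm_fourierOn, ← integral_const_mul]
    congr 1
    ext τ
    rw [← mul_assoc, ← exp_add]
    congr 2
    ring
  rw [e]
  exact key

theorem integrableOn_exp_mul_sideTerm (hP : IsConvexPolygon P) (i j : Fin n)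
    {φ : ℝ → ℝ} (hφ : IsTestDensity (halfLength P j) φ) (s : ℝ) :
    IntegrableOn (fun x : ℝ => exp (I * x * s) * sideTerm P i j (fourierOn (halfLength P j) φ) x)
      (Set.Iio 0) := by
  rcases eq_or_ne j i with rfl | hij
  · simp only [sideTerm_self]
    refine Integrable.mono hφ.integrable_fourierOn.integrableOn
      ((Continuous.aestronglyMeasurable (by fun_prop)).mul hφ.integrable_fourierOn.1.restrict) ?_
    filter_upwards with x
    rw [norm_mul, norm_exp]
    simp
  · exact (integral_exp_mul_sideTerm hP hij hφ s).1

theorem integrableOn_densityRelation (hP : IsConvexPolygon P) {φ : Fin n → ℝ → ℝ}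
    (hφ : ∀ i, IsTestDensity (halfLength P i) (φ i)) (i : Fin n) :
    IntegrableOn (densityRelation P φ i) (Set.Iio 0) := by
  unfold densityRelation
  refine integrable_finsetSum _ fun j _ => ?_
  have h := integrableOn_exp_mul_sideTerm hP i j (hφ j) 0
  simp only [ofReal_zero, mul_zero, exp_zero, one_mul] at h
  exact h

/-- The jump relation of the Cauchy integral on the sides of the polygon. -/
theorem sideDir_mul_interiorField (hP : IsConvexPolygon P) {φ : Fin n → ℝ → ℝ}
    (hφ : ∀ i, IsTestDensity (halfLength P i) (φ i)) (i : Fin n) {s : ℝ}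
    (hs : s ∈ Set.Ioo (-halfLength P i) (halfLength P i)) :
    sideDir P i * interiorField P φ (sidePoint P i s) = φ i s - exteriorTrace P φ i s := by
  have hpi : (2 * Real.pi : ℂ) ≠ 0 := by exact_mod_cast (by positivity : 2 * Real.pi ≠ 0)
  have hterm : ∀ j, sideDir P i * ((2 * Real.pi : ℂ)⁻¹ * (sideDir P j)⁻¹ *
      halfLineTransform (fun x : ℝ => fourierOn (halfLength P j) (φ j) x)
        (sideCoord P j (sidePoint P i s)))
      = (if j = i then (φ i s : ℂ) else 0) - (2 * Real.pi : ℂ)⁻¹ * ∫ x in Set.Iio (0 : ℝ),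
        exp (I * x * s) * sideTerm P i j (fourierOn (halfLength P j) (φ j)) x := by
    intro j
    rcases eq_or_ne j i with rfl | hij
    -- On its own side the kernel is singular; Fourier inversion splits `2π φ_i` into the half over
    -- `x > 0` (the field) and the half over `x < 0` (the exterior trace).
    · rw [if_pos rfl, sideCoord_sidePoint]
      simp only [sideTerm_self]
      have hint : Integrable fun x : ℝ => exp (I * x * s) * fourierOn (halfLength P j) (φ j) x := by
        refine (hφ j).integrable_fourierOn.mono
          ((Continuous.aestronglyMeasurable (by fun_prop)).mul (hφ j).integrable_fourierOn.1) ?_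
        filter_upwards with x
        rw [norm_mul, norm_exp]
        simp
      have h1 := (hφ j).fourier_inversion s
      rw [← integral_add_compl measurableSet_Iio hint, Set.compl_Iio,
        integral_Ici_eq_integral_Ioi] at h1
      change _ + halfLineTransform _ _ = _ at h1
      rw [mul_assoc, mul_left_comm, mul_inv_cancel_left₀ (sideDir_ne_zero j),
        eq_sub_of_add_eq' h1, mul_sub, inv_mul_cancel_left₀ hpi]
    · rw [if_neg hij, halfLineTransform_fourierOn (hφ j)
        (hP.im_sideCoord_sidePoint_pos hij.symm hs), (integral_exp_mul_sideTerm hP hij (hφ j) s).2,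
        ← integral_const_mul, ← integral_const_mul, ← integral_const_mul, zero_sub, ← integral_neg]
      refine integral_congr_ae (Filter.Eventually.of_forall fun τ => ?_)
      have e1 := sideDir_mul_sideCoord (P := P) j (sidePoint P i s)
      have e2 := sideDir_mul_sideCoord (P := P) i (sidePoint P j τ)
      have h3 := sideDir_ne_zero (P := P) j
      have h4 := sideDir_ne_zero (P := P) i
      have h0 : sideCoord P j (sidePoint P i s) - τ ≠ 0 := fun h => by
        have := congrArg im h
        simp at this
        linarith [hP.im_sideCoord_sidePoint_pos hij.symm hs]
      -- Both sides are the difference of the two boundary points, so the interior and exterior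
      -- terms carry the same Cauchy kernel up to sign.
      have e3 : sideDir P i * (sideCoord P i (sidePoint P j τ) - s)
          = -(sideDir P j * (sideCoord P j (sidePoint P i s) - τ)) := by
        rw [mul_sub, mul_sub, e1, e2, sidePoint, sidePoint]; ring
      have e4 : sideCoord P i (sidePoint P j τ) - s
          = -((sideDir P i)⁻¹ * (sideDir P j * (sideCoord P j (sidePoint P i s) - τ))) := by
        rw [← mul_neg, ← e3, inv_mul_cancel_left₀ h4]
      dsimp only
      rw [e4]
      field_simp
  rw [interiorField, Finset.mul_sum, Finset.sum_congr rfl fun j _ => hterm j,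
    Finset.sum_sub_distrib, Finset.sum_ite_eq' Finset.univ i, if_pos (Finset.mem_univ i),
    ← Finset.mul_sum, exteriorTrace]
  congr 2
  rw [← integral_finsetSum _ fun j _ => integrableOn_exp_mul_sideTerm hP i j (hφ j) s]
  congr 1
  ext x
  rw [densityRelation, Finset.mul_sum]

/-! ### Plancherel for the exterior trace. -/

theorem exteriorTrace_eq (φ : Fin n → ℝ → ℝ) (i : Fin n) (s : ℝ) :
    exteriorTrace P φ i s = (2 * Real.pi : ℂ)⁻¹ * FourierTransform.fourier
      ((Set.Iio 0).indicator (densityRelation P φ i)) (0 + -(2 * Real.pi)⁻¹ * s) := by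
  rw [exteriorTrace, Real.fourier_real_eq_integral_exp_smul, ← integral_indicator measurableSet_Iio]
  congr 2
  ext x
  by_cases hx : x ∈ Set.Iio (0 : ℝ)
  · rw [Set.indicator_of_mem hx, Set.indicator_of_mem hx, smul_eq_mul]
    congr 2
    have : (Real.pi : ℂ) ≠ 0 := by exact_mod_cast Real.pi_ne_zero
    push_cast
    field_simp
    ring
  · rw [Set.indicator_of_notMem hx, Set.indicator_of_notMem hx, smul_zero]

theorem continuous_exteriorTrace (hP : IsConvexPolygon P) {φ : Fin n → ℝ → ℝ}
    (hφ : ∀ i, IsTestDensity (halfLength P i) (φ i)) (i : Fin n) :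
    Continuous (exteriorTrace P φ i) := by
  have hc : Continuous (FourierTransform.fourier
      ((Set.Iio 0).indicator (densityRelation P φ i)) : ℝ → ℂ) :=
    VectorFourier.fourierIntegral_continuous Real.continuous_fourierChar
      (by exact continuous_inner)
      ((integrable_indicator_iff measurableSet_Iio).2 (integrableOn_densityRelation hP hφ i))
  rw [funext fun s => exteriorTrace_eq (P := P) φ i s]
  exact continuous_const.mul (hc.comp (by fun_prop))

theorem lintegral_enorm_exteriorTrace_sq (hP : IsConvexPolygon P) {φ : Fin n → ℝ → ℝ}
    (hφ : ∀ i, IsTestDensity (halfLength P i) (φ i)) (i : Fin n)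
    (h2 : MemLp (densityRelation P φ i) 2 (volume.restrict (Set.Iio 0))) :
    ∫⁻ s, ‖exteriorTrace P φ i s‖ₑ ^ 2 = ENNReal.ofReal (2 * Real.pi)⁻¹ *
      ∫⁻ x in Set.Iio (0 : ℝ), ‖densityRelation P φ i x‖ₑ ^ 2 := by
  have hp : -(2 * Real.pi)⁻¹ ≠ 0 := neg_ne_zero.2 (by positivity)
  have h1 := (integrable_indicator_iff measurableSet_Iio).2 (integrableOn_densityRelation hP hφ i)
  have h3 := (memLp_indicator_iff_restrict measurableSet_Iio).2 h2
  have h4 : ∀ s, ‖exteriorTrace P φ i s‖ₑ ^ 2 = ENNReal.ofReal ((2 * Real.pi)⁻¹ ^ 2) *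
      ‖FourierTransform.fourier ((Set.Iio 0).indicator (densityRelation P φ i))
        (0 + -(2 * Real.pi)⁻¹ * s)‖ₑ ^ 2 := by
    intro s
    rw [exteriorTrace_eq, enorm_mul, mul_pow, ← ofReal_norm (2 * Real.pi : ℂ)⁻¹,
      ← ENNReal.ofReal_pow (norm_nonneg _)]
    congr 3
    rw [norm_inv, norm_mul, norm_real, Real.norm_of_nonneg Real.pi_pos.le]
    simp
  simp only [h4]
  rw [lintegral_const_mul' _ _ ENNReal.ofReal_ne_top,
    lintegral_comp_add_mul hp 0 (fun y => ‖FourierTransform.fourier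
      ((Set.Iio 0).indicator (densityRelation P φ i)) y‖ₑ ^ 2),
    lintegral_enorm_fourier_sq h1 h3, ← mul_assoc, ← ENNReal.ofReal_mul (by positivity),
    ← lintegral_indicator measurableSet_Iio]
  congr 2
  · rw [inv_neg, inv_inv, abs_neg, abs_of_pos (by positivity)]
    field_simp
  · ext x
    by_cases hx : x ∈ Set.Iio (0 : ℝ)
    · rw [Set.indicator_of_mem hx, Set.indicator_of_mem hx]
    · rw [Set.indicator_of_notMem hx, Set.indicator_of_notMem hx]; simp

/-! ### The Rellich estimate. -/

/-- Since `x` is real, the term `w x²` contributes at least `d x²`; a complex `x` would allow any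
phase. Young's inequality spends half of it on the cross term `2 x v w`. -/
theorem rellich_pointwise {d R : ℝ} (hd : 0 < d) {x : ℝ} {v w : ℂ} (hw : w.im ≤ -d)
    (hR : ‖w‖ ≤ R) :
    d / 2 * x ^ 2 - (R + 2 * R ^ 2 / d) * ‖v‖ ^ 2 ≤ -(w * (x - v) ^ 2).im := by
  have h0 : 0 ≤ R := (norm_nonneg w).trans hR
  have e : (w * (x - v) ^ 2).im = w.im * x ^ 2 + (w * (v ^ 2 - 2 * x * v)).im := by
    have : w * (x - v) ^ 2 = w * ((x ^ 2 : ℝ) : ℂ) + w * (v ^ 2 - 2 * x * v) := by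
      push_cast; ring
    rw [this, add_im, im_mul_ofReal]
  have h1 : (w * (v ^ 2 - 2 * x * v)).im ≤ R * (‖v‖ ^ 2 + 2 * |x| * ‖v‖) := by
    refine (im_le_norm _).trans ?_
    rw [norm_mul]
    refine mul_le_mul hR ((norm_sub_le _ _).trans (le_of_eq ?_)) (norm_nonneg _) h0
    simp
  have h2 : R * (2 * |x| * ‖v‖) ≤ d / 2 * x ^ 2 + 2 * R ^ 2 / d * ‖v‖ ^ 2 := by
    have h3 : 0 ≤ (d * |x| - 2 * R * ‖v‖) ^ 2 / (2 * d) := by positivity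
    have h4 : (d * |x| - 2 * R * ‖v‖) ^ 2 / (2 * d)
        = d / 2 * |x| ^ 2 + 2 * R ^ 2 / d * ‖v‖ ^ 2 - R * (2 * |x| * ‖v‖) := by
      field_simp; ring
    rw [h4, sq_abs] at h3
    linarith
  rw [e]
  nlinarith [mul_le_mul_of_nonneg_right hw (sq_nonneg x)]

/-- The Rellich estimate: the densities are controlled by the traces of the exterior Cauchy
integral. -/
theorem IsConvexPolygon.exists_rellich (hP : IsConvexPolygon P) :
    ∃ c : ℝ, 0 < c ∧ ∀ φ : Fin n → ℝ → ℝ, (∀ i, IsTestDensity (halfLength P i) (φ i)) →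
      c * ∑ i, ∫ s in Set.Ioo (-halfLength P i) (halfLength P i), φ i s ^ 2
        ≤ ∑ i, ∫ s in Set.Ioo (-halfLength P i) (halfLength P i),
          ‖exteriorTrace P φ i s‖ ^ 2 := by
  obtain ⟨z₀, hz₀⟩ := hP.exists_interior
  have : Nonempty (Fin n) := ⟨⟨0, by have := hP.1; omega⟩⟩
  -- `d` is the least distance from `z₀` to the lines of the sides; `R` below bounds `|s - w_i(z₀)|`
  -- on every side. Both depend only on the polygon.
  obtain ⟨i₀, hi₀⟩ := Finite.exists_min fun i => (sideCoord P i z₀).im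
  set d := (sideCoord P i₀ z₀).im with hd_def
  have hd : 0 < d := hz₀ i₀
  obtain ⟨i₁, hi₁⟩ := Finite.exists_max fun i => halfLength P i + ‖sideCoord P i z₀‖
  set R := halfLength P i₁ + ‖sideCoord P i₁ z₀‖ with hR_def
  have hR0 : 0 < R := add_pos_of_pos_of_nonneg (hP.halfLength_pos i₁) (norm_nonneg _)
  set M := R + 2 * R ^ 2 / d with hM_def
  have hM : 0 < M := by positivity
  refine ⟨d / 2 / M, by positivity, fun φ hφ => ?_⟩
  have hcauchy := hP.sum_integral_eq_zero (f := fun z => (z - z₀) * interiorField P φ z ^ 2)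
    (ContinuousOn.mul (by fun_prop) ((continuousOn_interiorField hφ).pow 2))
    (DifferentiableOn.mul (by fun_prop) ((differentiableOn_interiorField hφ).pow 2))
  -- Of the two factors `sideDir P i`, one comes from `z - z₀` and one from `dz`; they turn `u²`
  -- into `(sideDir P i * u)²`, to which the jump relation applies.
  have hside : ∀ i, ∫ s in (-halfLength P i)..(halfLength P i),
      (sidePoint P i s - z₀) * interiorField P φ (sidePoint P i s) ^ 2 * sideDir P i
      = ∫ s in Set.Ioo (-halfLength P i) (halfLength P i),
        (s - sideCoord P i z₀) * (φ i s - exteriorTrace P φ i s) ^ 2 := by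
    intro i
    rw [intervalIntegral.integral_of_le (by linarith [hP.halfLength_pos i]),
      integral_Ioc_eq_integral_Ioo]
    refine setIntegral_congr_fun measurableSet_Ioo fun s hs => ?_
    rw [← sideDir_mul_interiorField hP hφ i hs]
    have e1 := sideDir_mul_sideCoord (P := P) i (sidePoint P i s)
    have e2 := sideDir_mul_sideCoord (P := P) i z₀
    rw [sideCoord_sidePoint] at e1
    linear_combination (e2 - e1) * interiorField P φ (sidePoint P i s) ^ 2 * sideDir P i
  rw [Finset.sum_congr rfl fun i _ => hside i] at hcauchy
  have hint : ∀ (i : Fin n) {f : ℝ → ℂ}, Continuous f →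
      IntegrableOn f (Set.Ioo (-halfLength P i) (halfLength P i)) := fun i f hf =>
    (hf.integrableOn_Icc).mono_set Set.Ioo_subset_Icc_self
  have hint' : ∀ (i : Fin n) {f : ℝ → ℝ}, Continuous f →
      IntegrableOn f (Set.Ioo (-halfLength P i) (halfLength P i)) := fun i f hf =>
    (hf.integrableOn_Icc).mono_set Set.Ioo_subset_Icc_self
  have hφc : ∀ i, Continuous (φ i) := fun i => (hφ i).1.continuous
  have hVc : ∀ i, Continuous (exteriorTrace P φ i) := continuous_exteriorTrace hP hφ
  have hineq : ∀ i, d / 2 * (∫ s in Set.Ioo (-halfLength P i) (halfLength P i), φ i s ^ 2)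
      - M * (∫ s in Set.Ioo (-halfLength P i) (halfLength P i), ‖exteriorTrace P φ i s‖ ^ 2)
      ≤ -(∫ s in Set.Ioo (-halfLength P i) (halfLength P i),
        (s - sideCoord P i z₀) * (φ i s - exteriorTrace P φ i s) ^ 2).im := by
    intro i
    have hV := hVc i
    have hf := hφc i
    have hcont : Continuous fun s : ℝ =>
        (s - sideCoord P i z₀) * (φ i s - exteriorTrace P φ i s) ^ 2 := by fun_prop
    rw [← integral_const_mul, ← integral_const_mul,
      ← integral_sub (hint' i (by fun_prop)) (hint' i (by fun_prop)),
      show ∀ z : ℂ, z.im = RCLike.im z from fun _ => rfl, ← integral_im (hint i hcont),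
      ← integral_neg]
    refine setIntegral_mono_on (hint' i (by fun_prop))
      (hint' i (continuous_im.comp hcont).neg) measurableSet_Ioo fun s hs => ?_
    refine rellich_pointwise hd ?_ ?_
    · rw [sub_im, ofReal_im, zero_sub]
      exact neg_le_neg (hi₀ i)
    · refine (norm_sub_le _ _).trans (le_trans ?_ (hi₁ i))
      rw [norm_real]
      exact add_le_add (abs_le.2 ⟨hs.1.le, hs.2.le⟩) le_rfl
  have hsum := Finset.sum_le_sum fun i (_ : i ∈ Finset.univ) => hineq i
  rw [Finset.sum_neg_distrib, ← im_sum, hcauchy, Finset.sum_sub_distrib, ← Finset.mul_sum,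
    ← Finset.mul_sum, zero_im, neg_zero] at hsum
  rw [div_mul_eq_mul_div, div_le_iff₀ hM]
  linarith

/-! ### The lower bound -/

theorem PWSym.norm_ofDensity_sq {σ : ℝ} {φ : ℝ → ℝ} (hφ : IsTestDensity σ φ) :
    ‖ofDensity φ (hφ.memLp (volume.restrict (Set.Icc (-σ) σ)))‖ ^ 2
      = 2 * Real.pi * ∫ s in Set.Ioo (-σ) σ, φ s ^ 2 := by
  have hc : Continuous φ := hφ.1.continuous
  have hi : IntegrableOn (fun s => φ s ^ 2) (Set.Ioo (-σ) σ) :=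
    ((hc.pow 2).integrableOn_Icc).mono_set Set.Ioo_subset_Icc_self
  have h := enorm_ofDensity_sq (hφ.memLp (volume.restrict (Set.Icc (-σ) σ)))
  have h1 : ∫⁻ τ in Set.Icc (-σ) σ, ‖φ τ‖ₑ ^ 2
      = ENNReal.ofReal (∫ s in Set.Ioo (-σ) σ, φ s ^ 2) := by
    rw [ofReal_integral_eq_lintegral_ofReal hi (by filter_upwards with x; positivity),
      ← setLIntegral_congr Ioo_ae_eq_Icc]
    refine lintegral_congr fun τ => ?_
    rw [← ofReal_norm, ← ENNReal.ofReal_pow (norm_nonneg _), Real.norm_eq_abs, sq_abs]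
  have h0 : 0 ≤ ∫ s in Set.Ioo (-σ) σ, φ s ^ 2 := integral_nonneg fun s => sq_nonneg _
  rw [h1, ← ENNReal.ofReal_mul (by positivity), ← ofReal_norm,
    ← ENNReal.ofReal_pow (norm_nonneg _)] at h
  exact (ENNReal.ofReal_eq_ofReal_iff (by positivity) (by positivity)).1 h

/-- The integral over the side is enlarged to the whole line, where Plancherel is an equality. -/
theorem integral_norm_exteriorTrace_sq_le (hP : IsConvexPolygon P) {φ : Fin n → ℝ → ℝ}
    (hφ : ∀ i, IsTestDensity (halfLength P i) (φ i)) (i : Fin n)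
    (F : Lp ℂ 2 (volume.restrict (Set.Iio (0 : ℝ))))
    (hF : F =ᵐ[volume.restrict (Set.Iio (0 : ℝ))] densityRelation P φ i) :
    ∫ s in Set.Ioo (-halfLength P i) (halfLength P i), ‖exteriorTrace P φ i s‖ ^ 2
      ≤ (2 * Real.pi)⁻¹ * ‖F‖ ^ 2 := by
  have hV := continuous_exteriorTrace hP hφ i
  have hi : IntegrableOn (fun s => ‖exteriorTrace P φ i s‖ ^ 2)
      (Set.Ioo (-halfLength P i) (halfLength P i)) :=
    ((hV.norm.pow 2).integrableOn_Icc).mono_set Set.Ioo_subset_Icc_self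
  rw [← ENNReal.ofReal_le_ofReal_iff (by positivity),
    ofReal_integral_eq_lintegral_ofReal hi (by filter_upwards with x; positivity),
    ENNReal.ofReal_mul (by positivity), ENNReal.ofReal_pow (norm_nonneg _), ofReal_norm,
    Lp.enorm_def, eLpNorm_congr_ae hF, eLpNorm_two_sq,
    ← lintegral_enorm_exteriorTrace_sq hP hφ i ((memLp_congr_ae hF).1 (Lp.memLp F))]
  refine le_trans (setLIntegral_le_lintegral _ _) (le_of_eq (lintegral_congr fun s => ?_))
  rw [ENNReal.ofReal_pow (norm_nonneg _), ofReal_norm]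

/-- Elements of `X_sym` with smooth densities supported in the open sides are dense. -/
theorem dense_testDensity (P : Polygon ℂ n) :
    Dense {Φ : XSym P | ∃ φ : Fin n → ℝ → ℝ, ∃ h : ∀ i, IsTestDensity (halfLength P i) (φ i),
      ∀ i, Φ i = PWSym.ofDensity (φ i) ((h i).memLp _)} := by
  have h1 := dense_pi Set.univ fun (i : Fin n) _ => PWSym.dense_testDensity (halfLength P i)
  have h2 := h1.preimage (PiLp.continuousLinearEquiv 2 ℝ
    fun i : Fin n => PWSym (halfLength P i)).toHomeomorph.isOpenMap
  refine h2.mono fun Φ hΦ => ?_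
  have h3 : ∀ i, ∃ φ, ∃ h : IsTestDensity (halfLength P i) φ,
      Φ i = PWSym.ofDensity φ (h.memLp _) := fun i => hΦ i (Set.mem_univ i)
  choose φ h hφ using h3
  exact ⟨φ, h, hφ⟩

theorem IsConvexPolygon.exists_lower_bound (hP : IsConvexPolygon P)
    {T : XSym P →L[ℝ] YSpace n} (hT : ∀ (Φ : XSym P) (i : Fin n),
      (T Φ i : ℝ → ℂ) =ᵐ[volume.restrict (Set.Iio (0 : ℝ))]
        fun x : ℝ => globalRelation P Φ i (x : ℂ)) :
    ∃ c : ℝ, 0 < c ∧ ∀ Φ : XSym P, c * ‖Φ‖ ≤ ‖T Φ‖ := by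
  obtain ⟨c, hc, hbound⟩ := hP.exists_rellich
  refine ⟨Real.sqrt c, Real.sqrt_pos.2 hc, fun Φ => ?_⟩
  -- The inequality is closed in `Φ` because `T` is continuous, so test densities suffice. The
  -- factors `2π` in `h1` and `h2` below cancel, leaving `√c`.
  refine isClosed_property (b := Φ) (e := fun Φ : {Φ : XSym P | ∃ φ : Fin n → ℝ → ℝ,
    ∃ h : ∀ i, IsTestDensity (halfLength P i) (φ i),
      ∀ i, Φ i = PWSym.ofDensity (φ i) ((h i).memLp _)} => (Φ : XSym P))
    (dense_testDensity P).denseRange_val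
    (isClosed_le (continuous_const.mul continuous_norm) T.continuous.norm) ?_
  rintro ⟨Φ, φ, hφ, hΦ⟩
  change Real.sqrt c * ‖Φ‖ ≤ ‖T Φ‖
  have hrel : ∀ i, T Φ i =ᵐ[volume.restrict (Set.Iio (0 : ℝ))] densityRelation P φ i := by
    intro i
    filter_upwards [hT Φ i] with x hx
    rw [hx, globalRelation_eq_sum, densityRelation]
    exact Finset.sum_congr rfl fun j _ => by rw [hΦ j, PWSym.eval_ofDensity]
  have h1 : ‖Φ‖ ^ 2 = 2 * Real.pi *
      ∑ i, ∫ s in Set.Ioo (-halfLength P i) (halfLength P i), φ i s ^ 2 := by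
    rw [PiLp.norm_sq_eq_of_L2, Finset.mul_sum]
    exact Finset.sum_congr rfl fun i _ => by rw [hΦ i, PWSym.norm_ofDensity_sq (hφ i)]
  have h2 : ∑ i, ∫ s in Set.Ioo (-halfLength P i) (halfLength P i),
      ‖exteriorTrace P φ i s‖ ^ 2 ≤ (2 * Real.pi)⁻¹ * ‖T Φ‖ ^ 2 := by
    rw [PiLp.norm_sq_eq_of_L2, Finset.mul_sum]
    exact Finset.sum_le_sum fun i _ => integral_norm_exteriorTrace_sq_le hP hφ i _ (hrel i)
  have h3 := (hbound φ hφ).trans h2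
  rw [inv_mul_eq_div, le_div_iff₀ (by positivity)] at h3
  refine (pow_le_pow_iff_left₀ (by positivity) (norm_nonneg _) two_ne_zero).1 ?_
  rw [mul_pow, Real.sq_sqrt hc.le, h1]
  linarith

end GlobalRelation

end

/-- For a convex polygon, the global relation operator is a bounded operator from `X_sym` to `Y`
and is bounded below. -/
theorem lemma6 {n : ℕ} (P : Polygon ℂ n) (hP : GlobalRelation.IsConvexPolygon P) :
    ∃ T : GlobalRelation.XSym P →L[ℝ] GlobalRelation.YSpace n,
      (∀ (Φ : GlobalRelation.XSym P) (i : Fin n),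
        (T Φ i : ℝ → ℂ) =ᵐ[MeasureTheory.volume.restrict (Set.Iio (0 : ℝ))]
          fun x : ℝ => GlobalRelation.globalRelation P Φ i (x : ℂ)) ∧
      ∃ c : ℝ, 0 < c ∧ ∀ Φ : GlobalRelation.XSym P, c * ‖Φ‖ ≤ ‖T Φ‖ := by
  obtain ⟨T, hT⟩ := hP.exists_operator
  exact ⟨T, hT, hP.exists_lower_bound hT⟩
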